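/- **Notation.** Let $G=\mathrm{SL}(2,\mathbb R)$, $K=\mathrm{SO}(2)=\{k_\theta\}$ with $k_\theta=\begin{pmatrix}\cos\theta&\sin\theta\\-\sin\theta&\cos\theta\end{pmatrix}$, $e_n(k_\theta)=e^{in\theta}$, and let $m$ be a Haar measure on $G$. For $x=\begin{pmatrix}a&b\\c&d\end{pmatrix}\in G$ let $H(x)\in\mathbb R$ and $K(x)\in K$ be the Iwasawa components of $x$, so that $e^{2H(x)}=a^2+c^2$ and $K(x)=k_\theta$ with $e^{i\theta}=(a-ic)/\sqrt{a^2+c^2}$. For $\lambda\in\mathbb C$ the principal series acts on functions on $K$ by $$(\pi_{\tau,\lambda}(x)f)(\kappa)=e^{(i\lambda-1)H(x^{-1}\kappa^{-1})}\,f\big(K(x^{-1}\kappa^{-1})^{-1}\big),$$ $\pi_{\tau,\lambda}$ being its restriction to the closed span in $L^2(K)$ of the $e_n$ with $n$ of parity $\tau$. For a nonzero integer $k$ let $\mathbb Z(k)$ be the set of integers $n$ of parity opposite to $k$ with $n\ge k+1$ if $k\ge1$, and $n\le k-1$ if $k\le-1$. The discrete series representation $(\pi_{ik},H_k)$ is the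 subrepresentation of $\pi_{\tau,i|k|}$ (where $\tau$ is the parity opposite to $k$) with $K$-types $e_n$, $n\in\mathbb Z(k)$, made unitary by renormalizing the inner product: the $e_n$ are orthogonal with $\langle e_n,e_n\rangle_k=\frac{j!\,|k|!}{(j+|k|)!}$ for $|n|=|k|+1+2j$, and $H_k$ is the completion of their span. For $0<p\le2$, $L^{p,\infty}(G)$ is the set of measurable $f:G\to\mathbb C$ with $\sup_{\alpha>0}\alpha^p\,m\{x\in G:|f(x)|>\alpha\}<\infty$. Let $E_{p,\infty}(G)$ be the set of equivalence classes of irreducible unitary representations $\pi$ of $G$ all of whose $K$-finite matrix coefficients $x\mapsto\langle\pi(x)u,v\rangle$ ($u,v$ $K$-finite) lie in $L^{p,\infty}(G)$. **Theorem.** Let $0<p\le2$ and $\gamma_p=\frac2p-1$, and let $k$ be a nonzero integer. Then the following are equivalent: 1. $|k|\ge\gamma_p$; 2. the discrete series representation $(\pi_{ik},H_k)$ is in $E_{p,\infty}(G)$. -/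

import Mathlib

open MeasureTheory Complex
open scoped ENNReal ComplexConjugate

noncomputable section

/-! ### Unitary representations and weak `L^p` spaces -/

/-- A unitary representation of the topological group `G` on the Hilbert space `H`: a homomorphism
into the unitary operators of `H` all of whose orbit maps are continuous. -/
structure UnitaryRep (G : Type*) [Group G] [TopologicalSpace G]
    (H : Type*) [NormedAddCommGroup H] [InnerProductSpace ℂ H] where
  toHom : G →* (H ≃ₗᵢ[ℂ] H)
  continuous_orbit : ∀ v : H, Continuous fun x => toHom x v

namespace UnitaryRep

/-- The matrix coefficient `x ↦ ⟨π(x) u, v⟩` (`inner` is conjugate linear in its first argument). -/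
def matrixCoeff {G : Type*} [Group G] [TopologicalSpace G]
    {H : Type*} [NormedAddCommGroup H] [InnerProductSpace ℂ H]
    (π : UnitaryRep G H) (u v : H) (x : G) : ℂ :=
  inner ℂ v (π.toHom x u)

/-- Topological irreducibility: `H ≠ 0`, and `0` and `H` are the only closed invariant subspaces. -/
def IsIrreducible {G : Type*} [Group G] [TopologicalSpace G]
    {H : Type*} [NormedAddCommGroup H] [InnerProductSpace ℂ H]
    (π : UnitaryRep G H) : Prop :=
  Nontrivial H ∧ ∀ W : Submodule ℂ H, IsClosed (W : Set H) →
    (∀ x : G, ∀ w ∈ W, π.toHom x w ∈ W) → W = ⊥ ∨ W = ⊤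

/-- `v` is `K`-finite: the translates `π(κ) v`, `κ ∈ K`, span a finite-dimensional space. -/
def IsKFinite {G : Type*} [Group G] [TopologicalSpace G]
    {H : Type*} [NormedAddCommGroup H] [InnerProductSpace ℂ H]
    (π : UnitaryRep G H) (K : Subgroup G) (v : H) : Prop :=
  FiniteDimensional ℂ (Submodule.span ℂ (Set.range fun κ : K => π.toHom (κ : G) v))

end UnitaryRep

/-- Membership in the Lorentz space `L^{p,∞}(X, μ)`: `f` is measurable and
`sup_{α > 0} α ^ p * d_f(α) < ∞`, where `d_f(α) = μ {x | |f x| > α}`. -/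
def MemWeakLp {X : Type*} [MeasurableSpace X] (f : X → ℂ) (p : ℝ) (μ : Measure X) : Prop :=
  Measurable f ∧ (⨆ α : Set.Ioi (0 : ℝ),
    ENNReal.ofReal ((α : ℝ) ^ p) * μ {x | (α : ℝ) < ‖f x‖}) < ∞

/-! ### The group `SL(2, ℝ)` and its principal series -/

namespace SL2R

/-- The group `G = SL(2, ℝ)`. -/
abbrev G : Type := Matrix.SpecialLinearGroup (Fin 2) ℝ

/-- The rotation `k_θ`. -/
def rot (θ : ℝ) : G :=
  ⟨!![Real.cos θ, Real.sin θ; -Real.sin θ, Real.cos θ], by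
    rw [Matrix.det_fin_two_of]; nlinarith [Real.sin_sq_add_cos_sq θ]⟩

theorem coe_rot (θ : ℝ) : (rot θ : Matrix (Fin 2) (Fin 2) ℝ) =
    !![Real.cos θ, Real.sin θ; -Real.sin θ, Real.cos θ] := rfl

theorem rot_add (θ η : ℝ) : rot (θ + η) = rot θ * rot η := by
  apply Subtype.ext
  rw [Matrix.SpecialLinearGroup.coe_mul, coe_rot, coe_rot, coe_rot, Matrix.mul_fin_two,
    Real.cos_add, Real.sin_add]
  congr 1
  ext i j
  fin_cases i <;> fin_cases j <;> simp <;> ring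

theorem rot_zero : rot 0 = 1 := by
  ext i j
  fin_cases i <;> fin_cases j <;> simp [rot]

/-- The maximal compact subgroup `K = SO(2) = {k_θ}`. -/
def K : Subgroup G where
  carrier := Set.range rot
  mul_mem' := by
    rintro _ _ ⟨θ, rfl⟩ ⟨η, rfl⟩
    exact ⟨θ + η, rot_add θ η⟩
  one_mem' := ⟨0, rot_zero⟩
  inv_mem' := by
    rintro _ ⟨θ, rfl⟩
    refine ⟨-θ, ?_⟩
    rw [eq_inv_iff_mul_eq_one, ← rot_add, neg_add_cancel, rot_zero]

/-- The rotation `k_θ` as an element of `K`. -/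
def rotK (θ : ℝ) : K := ⟨rot θ, θ, rfl⟩

/-- The character `e_n(k_θ) = e^{i n θ}` of `K`, in terms of matrix entries. -/
def e (n : ℤ) (κ : K) : ℂ :=
  (((κ : G) 0 0 : ℂ) - I * ((κ : G) 1 0 : ℂ)) ^ n

/-- `H(x) = t` in the Iwasawa decomposition `x = k_θ a_t n_v`; here `e^{2t} = a² + c²`,
where `(a, c)` is the first column of `x`. -/
def iwasawaH (x : G) : ℝ := Real.log (x 0 0 ^ 2 + x 1 0 ^ 2) / 2

/-- `K(x) = k_θ` in the Iwasawa decomposition `x = k_θ a_t n_v`; here `θ` is the argument of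
`a - i c`, where `(a, c)` is the first column of `x`. -/
def iwasawaK (x : G) : K := rotK (Complex.arg ((x 0 0 : ℂ) - I * (x 1 0 : ℂ)))

/-- The principal series with parameter `lam`:
`(π_lam(x) f)(κ) = e^{(i lam - 1) H(x⁻¹ κ⁻¹)} f(K(x⁻¹ κ⁻¹)⁻¹)` for functions `f` on `K`.
The representation `π_{τ, lam}` is its restriction to the closed span of the `e_n`
with `n` of parity `τ`. -/
def principalSeries (lam : ℂ) (x : G) (f : K → ℂ) (κ : K) : ℂ :=
  Complex.exp ((I * lam - 1) * (iwasawaH (x⁻¹ * (κ : G)⁻¹) : ℂ)) *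
    f (iwasawaK (x⁻¹ * (κ : G)⁻¹))⁻¹

/-- The inner product `⟨f, g⟩ = ∫_K f(κ) conj(g(κ)) dκ` of `L²(K)`, with `∫_K dκ = 1`. -/
def innerL2K (f g : K → ℂ) : ℂ :=
  (2 * Real.pi : ℂ)⁻¹ * ∫ θ in (0 : ℝ)..(2 * Real.pi), f (rotK θ) * conj (g (rotK θ))

/-! ### The discrete series -/

/-- The set `ℤ(k)` of `K`-types of the discrete series representation with parameter `k ≠ 0`:
the integers `m` of parity opposite to that of `k` with `m ≥ k + 1` if `k ≥ 1`, and with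
`m ≤ k - 1` if `k ≤ -1`. -/
def KType (k : ℤ) : Set ℤ :=
  {m | Odd (m - k) ∧ (1 ≤ k → k + 1 ≤ m) ∧ (k ≤ -1 → m ≤ k - 1)}

/-- The renormalized squared norm `⟨e_m, e_m⟩_k = j! |k|! / (j + |k|)!` of `e_m`, where
`m ∈ ℤ(k)` and `|m| = |k| + 1 + 2 j`. Up to a positive factor this is the only choice of squared
norms of the orthogonal vectors `e_m`, `m ∈ ℤ(k)`, that makes the subrepresentation of
`π_{τ, i|k|}` with these `K`-types unitary. -/
def renormSq (k m : ℤ) : ℝ :=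
  (((m.natAbs + k.natAbs - 1) / 2).choose k.natAbs : ℝ)⁻¹

/-- The Hilbert space `H_k`, the completion of the span of the `e_m`, `m ∈ ℤ(k)`, for the
renormalized inner product, written in coordinates with respect to the orthonormal basis
of the vectors `e_m^k = ⟨e_m, e_m⟩_k ^ (-1/2) • e_m`, `m ∈ ℤ(k)`. -/
abbrev H (k : ℤ) : Type := lp (fun _ : KType k => ℂ) 2

open Classical in
/-- The renormalized basis vector `e_m^k` of `H_k`. -/
def basisVec (k : ℤ) (m : KType k) : H k := lp.single 2 m (1 : ℂ)

/-- `π` is the subrepresentation of `π_{τ, i|k|}` with `K`-types `ℤ(k)`, for the renormalized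
inner product: since `e_m^k = ⟨e_m, e_m⟩_k ^ (-1/2) • e_m`, its matrix entries are
`⟨π(x) e_n^k, e_m^k⟩_k =
  ⟨e_m, e_m⟩_k ^ (1/2) ⟨e_n, e_n⟩_k ^ (-1/2) ⟨π_{τ, i|k|}(x) e_n, e_m⟩_{L²(K)}`. -/
def IsDiscreteSeries (k : ℤ) (π : UnitaryRep G (H k)) : Prop :=
  ∀ (x : G) (n m : KType k),
    π.matrixCoeff (basisVec k n) (basisVec k m) x =
      (Real.sqrt (renormSq k m / renormSq k n) : ℂ) *
        innerL2K (principalSeries (I * (|k| : ℤ)) x (e n)) (e m)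

/-! ### Construction of the discrete series -/

theorem continuous_of_inner {X V : Type*} [TopologicalSpace X] [NormedAddCommGroup V]
    [InnerProductSpace ℂ V] (f : X → V) (c : ℝ) (hf : ∀ x, ‖f x‖ = c)
    (h : ∀ x₀, Continuous fun x => inner ℂ (f x₀) (f x)) : Continuous f := by
  rw [continuous_iff_continuousAt]
  intro x₀
  rw [ContinuousAt, tendsto_iff_norm_sub_tendsto_zero]
  have h1 : ∀ x, ‖f x - f x₀‖ = Real.sqrt (2 * c ^ 2 - 2 * (inner ℂ (f x₀) (f x) : ℂ).re) := by
    intro x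
    have h2 := @norm_sub_sq ℂ V _ _ _ (f x) (f x₀)
    rw [hf, hf, ← inner_conj_symm, RCLike.conj_re] at h2
    rw [← Real.sqrt_sq (norm_nonneg (f x - f x₀)), h2]
    congr 1
    simp only [RCLike.re_to_complex]
    ring
  have h3 : (inner ℂ (f x₀) (f x₀) : ℂ).re = c ^ 2 := by
    rw [inner_self_eq_norm_sq_to_K, hf]
    norm_cast
  have h4 : Continuous fun x => ‖f x - f x₀‖ := by
    simp_rw [h1]
    have := h x₀
    fun_prop
  have h5 := h4.tendsto x₀
  simpa using h5

theorem exists_rep {Γ L V : Type*} [Group Γ] [TopologicalSpace Γ] [MulAction Γ L]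
    [NormedAddCommGroup V] [InnerProductSpace ℂ V] [CompleteSpace V] (κ : L → V)
    (hd : Dense (Submodule.span ℂ (Set.range κ) : Set V))
    (hi : ∀ (x : Γ) (l l' : L), inner ℂ (κ (x • l)) (κ (x • l')) = inner ℂ (κ l) (κ l'))
    (hc : ∀ l l' : L, Continuous fun x : Γ => inner ℂ (κ l) (κ (x • l'))) :
    ∃ π : UnitaryRep Γ V, ∀ x l, π.toHom x (κ l) = κ (x • l) := by
  classical
  set E : (L →₀ ℂ) →ₗ[ℂ] V := Finsupp.linearCombination ℂ κ with hE
  have hdE : DenseRange E := by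
    have : Set.range E = (Submodule.span ℂ (Set.range κ) : Set V) := by
      rw [← Finsupp.range_linearCombination]; rfl
    rw [DenseRange, this]; exact hd
  let T : Γ → ((L →₀ ℂ) ≃ₗ[ℂ] (L →₀ ℂ)) := fun x => Finsupp.domLCongr (MulAction.toPerm x)
  have hT : ∀ x l c, E (T x (Finsupp.single l c)) = c • κ (x • l) := by
    intro x l c
    simp [T, hE]
  have hin : ∀ x (a b : L →₀ ℂ), inner ℂ (E (T x a)) (E (T x b)) = inner ℂ (E a) (E b) := by
    intro x a b
    induction a using Finsupp.induction_linear with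
    | zero => simp
    | add a₁ a₂ h₁ h₂ => simp only [map_add, inner_add_left, h₁, h₂]
    | single l c =>
      induction b using Finsupp.induction_linear with
      | zero => simp
      | add a₁ a₂ h₁ h₂ => simp only [map_add, inner_add_right, h₁, h₂]
      | single l' c' =>
        rw [hT, hT]
        simp only [hE, Finsupp.linearCombination_single, inner_smul_left, inner_smul_right, hi]
  have hn : ∀ x a, ‖E (T x a)‖ = ‖E a‖ := by
    intro x a
    rw [@norm_eq_sqrt_re_inner ℂ, @norm_eq_sqrt_re_inner ℂ, hin]
  let U : Γ → (V ≃ₗᵢ[ℂ] V) := fun x => (T x).extendOfIsometry E E hdE hdE (hn x)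
  have hU : ∀ x l, U x (κ l) = κ (x • l) := by
    intro x l
    have h1 : U x (E (Finsupp.single l 1)) = E (T x (Finsupp.single l 1)) :=
      LinearEquiv.extendOfIsometry_eq ..
    rw [hT] at h1
    simpa [hE] using h1
  have hext : ∀ A B : V →L[ℂ] V, (∀ l, A (κ l) = B (κ l)) → A = B := by
    intro A B h
    refine ContinuousLinearMap.ext_on hd ?_
    rintro _ ⟨l, rfl⟩
    exact h l
  let π : Γ →* (V ≃ₗᵢ[ℂ] V) :=
    { toFun := U
      map_one' := by
        ext v
        have := hext (U 1 : V →L[ℂ] V) (ContinuousLinearMap.id ℂ V) (by intro l; simp [hU])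
        exact congrArg (fun A : V →L[ℂ] V => A v) this
      map_mul' := by
        intro x y
        ext v
        have := hext (U (x * y) : V →L[ℂ] V) ((U x : V →L[ℂ] V).comp (U y : V →L[ℂ] V))
          (by intro l; simp [hU, mul_smul])
        exact congrArg (fun A : V →L[ℂ] V => A v) this }
  have hπ : ∀ x l, π x (κ l) = κ (x • l) := hU
  refine ⟨⟨π, fun v => ?_⟩, hπ⟩
  have hκ : ∀ l, Continuous fun x => π x (κ l) := by
    intro l
    refine continuous_of_inner _ ‖κ l‖ (fun x => by simp) (fun x₀ => ?_)
    simp_rw [hπ]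
    exact hc _ _
  have hs : ∀ s ∈ Submodule.span ℂ (Set.range κ), Continuous fun x => π x s := by
    intro s hs
    induction hs using Submodule.span_induction with
    | mem s h => obtain ⟨l, rfl⟩ := h; exact hκ l
    | zero => simpa using continuous_const
    | add a b _ _ ha hb => simp only [map_add]; exact ha.add hb
    | smul c a _ ha => simp only [map_smul]; exact ha.const_smul c
  refine continuous_of_uniform_approx_of_continuous fun u hu => ?_
  obtain ⟨ε, hε, hεu⟩ := Metric.mem_uniformity_dist.1 hu
  obtain ⟨s, hsm, hsd⟩ := hd.exists_dist_lt v hε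
  refine ⟨fun x => π x s, hs s hsm, fun x => hεu ?_⟩
  simpa using hsd

/-- The `K`-types of the discrete series, numbered as `m = k + sign(k) (1 + 2 j)`. -/
def typeEquiv (k : ℤ) (hk : k ≠ 0) : ℕ ≃ KType k where
  toFun j := ⟨k + k.sign * (1 + 2 * j), by
    rcases lt_or_gt_of_ne hk with h | h
    · rw [Int.sign_eq_neg_one_of_neg h]
      exact ⟨⟨-j - 1, by ring⟩, by intro; omega, by intro; omega⟩
    · rw [Int.sign_eq_one_of_pos h]
      exact ⟨⟨j, by ring⟩, by intro; omega, by intro; omega⟩⟩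
  invFun m := ((m : ℤ).natAbs - k.natAbs - 1) / 2
  left_inv j := by
    rcases lt_or_gt_of_ne hk with h | h
    · simp only [Int.sign_eq_neg_one_of_neg h]; omega
    · simp only [Int.sign_eq_one_of_pos h]; omega
  right_inv m := by
    obtain ⟨m, ⟨r, hr⟩, h1, h2⟩ := m
    apply Subtype.ext
    rcases lt_or_gt_of_ne hk with h | h
    · simp only [Int.sign_eq_neg_one_of_neg h]; omega
    · simp only [Int.sign_eq_one_of_pos h]; omega

theorem natAbs_typeEquiv (k : ℤ) (hk : k ≠ 0) (j : ℕ) :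
    ((typeEquiv k hk j : KType k) : ℤ).natAbs = k.natAbs + 1 + 2 * j := by
  rcases lt_or_gt_of_ne hk with h | h
  · simp only [typeEquiv, Equiv.coe_fn_mk, Int.sign_eq_neg_one_of_neg h]; omega
  · simp only [typeEquiv, Equiv.coe_fn_mk, Int.sign_eq_one_of_pos h]; omega

/-- The binomial coefficient `⟨e_m, e_m⟩_k⁻¹` for the `K`-type with number `j`. -/
def binom (k : ℤ) (j : ℕ) : ℝ := ((j + k.natAbs).choose k.natAbs : ℝ)

theorem binom_pos (k : ℤ) (j : ℕ) : 0 < binom k j := by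
  unfold binom
  exact_mod_cast Nat.choose_pos (Nat.le_add_left _ _)

theorem renormSq_typeEquiv (k : ℤ) (hk : k ≠ 0) (j : ℕ) :
    renormSq k (typeEquiv k hk j : KType k) = (binom k j)⁻¹ := by
  rw [renormSq, binom, natAbs_typeEquiv]
  congr 4
  omega

theorem hasSum_binom (k : ℤ) {w : ℂ} (hw : ‖w‖ < 1) :
    HasSum (fun j => (binom k j : ℂ) * w ^ j) (((1 - w) ^ (k.natAbs + 1))⁻¹) := by
  simpa [binom] using hasSum_choose_mul_geometric_of_norm_lt_one k.natAbs hw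

theorem coeff_unique {a b : ℕ → ℂ} {f : ℂ → ℂ}
    (ha : ∀ w : ℂ, ‖w‖ < 1 → HasSum (fun j => a j * w ^ j) (f w))
    (hb : ∀ w : ℂ, ‖w‖ < 1 → HasSum (fun j => b j * w ^ j) (f w)) : a = b := by
  have key : ∀ c : ℕ → ℂ, (∀ w : ℂ, ‖w‖ < 1 → HasSum (fun j => c j * w ^ j) (f w)) →
      HasFPowerSeriesAt f (FormalMultilinearSeries.ofScalars ℂ c) 0 := by
    intro c hc
    rw [hasFPowerSeriesAt_iff]
    filter_upwards [Metric.ball_mem_nhds (0 : ℂ) one_pos] with z hz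
    simp only [FormalMultilinearSeries.coeff_ofScalars, smul_eq_mul, zero_add]
    simpa only [mul_comm] using hc z (by simpa using hz)
  have h := (key a ha).eq_formalMultilinearSeries (key b hb)
  funext j
  simpa using congrArg (fun s => FormalMultilinearSeries.coeff s j) h

/-- Coordinates of the linear functional `(v₁, v₂) ↦ u.1 v₁ + u.2 v₂` in terms of
`ζ = v₁ + i ε v₂`: it equals `P conj(ζ) + Q ζ`. Here `ε = sign k`. -/
def fP (k : ℤ) (u : ℂ × ℂ) : ℂ := (u.1 + I * (k.sign : ℂ) * u.2) / 2

def fQ (k : ℤ) (u : ℂ × ℂ) : ℂ := (u.1 - I * (k.sign : ℂ) * u.2) / 2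

/-- The action of `G` on linear functionals. -/
def act (x : G) (u : ℂ × ℂ) : ℂ × ℂ :=
  (u.1 * (x⁻¹ 0 0 : ℝ) + u.2 * (x⁻¹ 1 0 : ℝ), u.1 * (x⁻¹ 0 1 : ℝ) + u.2 * (x⁻¹ 1 1 : ℝ))

/-- The value of the linear functional at the first column of `x`. -/
def ell (u : ℂ × ℂ) (x : G) : ℂ := u.1 * (x 0 0 : ℝ) + u.2 * (x 1 0 : ℝ)

theorem mul_apply_two (x y : G) (i j : Fin 2) : (x * y) i j = x i 0 * y 0 j + x i 1 * y 1 j := by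
  rw [Matrix.SpecialLinearGroup.coe_mul, Matrix.mul_apply, Fin.sum_univ_two]

theorem ell_act (x g : G) (u : ℂ × ℂ) : ell (act x u) g = ell u (x⁻¹ * g) := by
  simp only [ell, act, mul_apply_two]
  push_cast
  ring

theorem act_one (u : ℂ × ℂ) : act 1 u = u := by
  simp [act]

theorem act_mul (x y : G) (u : ℂ × ℂ) : act (x * y) u = act x (act y u) := by
  simp only [act, mul_inv_rev, mul_apply_two]
  ext <;> push_cast <;> ring

theorem det_entries (x : G) : x 0 0 * x 1 1 - x 0 1 * x 1 0 = 1 := by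
  rw [← Matrix.det_fin_two, x.det_coe]

theorem sign_sq (k : ℤ) (hk : k ≠ 0) : (k.sign : ℂ) * k.sign = 1 := by
  rcases lt_or_gt_of_ne hk with h | h
  · rw [Int.sign_eq_neg_one_of_neg h]; norm_num
  · rw [Int.sign_eq_one_of_pos h]; norm_num

/-- The invariant Hermitian form on linear functionals. -/
def herm (k : ℤ) (u v : ℂ × ℂ) : ℂ := conj (fP k u) * fP k v - conj (fQ k u) * fQ k v

theorem herm_eq (k : ℤ) (u v : ℂ × ℂ) :
    herm k u v = I * (k.sign : ℂ) / 2 * (conj u.1 * v.2 - conj u.2 * v.1) := by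
  simp only [herm, fP, fQ, map_div₀, map_add, map_sub, map_mul, conj_I, map_intCast,
    Complex.conj_ofNat]
  ring

theorem herm_act (k : ℤ) (x : G) (u v : ℂ × ℂ) : herm k (act x u) (act x v) = herm k u v := by
  have h : ((x⁻¹ 0 0 : ℝ) : ℂ) * (x⁻¹ 1 1 : ℝ) - (x⁻¹ 0 1 : ℝ) * (x⁻¹ 1 0 : ℝ) = 1 := by
    exact_mod_cast det_entries x⁻¹
  simp only [herm_eq, act, map_add, map_mul, Complex.conj_ofReal]
  linear_combination (I * (k.sign : ℂ) / 2 * (conj u.1 * v.2 - conj u.2 * v.1)) * h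

/-- The functionals with `|Q| < |P|`. -/
abbrev Fnl (k : ℤ) : Type := {u : ℂ × ℂ // ‖fQ k u‖ < ‖fP k u‖}

theorem herm_self (k : ℤ) (u : ℂ × ℂ) : herm k u u = ((‖fP k u‖ ^ 2 - ‖fQ k u‖ ^ 2 : ℝ) : ℂ) := by
  simp only [herm, Complex.conj_mul']
  push_cast
  ring

theorem lt_iff_herm (k : ℤ) (u : ℂ × ℂ) : ‖fQ k u‖ < ‖fP k u‖ ↔ 0 < (herm k u u).re := by
  rw [herm_self, Complex.ofReal_re, sub_pos, sq_lt_sq₀ (norm_nonneg _) (norm_nonneg _)]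

instance (k : ℤ) : MulAction G (Fnl k) where
  smul x u := ⟨act x u.1, by rw [lt_iff_herm, herm_act, ← lt_iff_herm]; exact u.2⟩
  one_smul u := Subtype.ext (act_one u.1)
  mul_smul x y u := Subtype.ext (act_mul x y u.1)

theorem coe_smul (k : ℤ) (x : G) (u : Fnl k) : (x • u).1 = act x u.1 := rfl

theorem fP_ne (k : ℤ) (u : Fnl k) : fP k u.1 ≠ 0 :=
  norm_pos_iff.1 ((norm_nonneg _).trans_lt u.2)

/-- The ratio `-Q / P`, a point of the unit disc. -/
def fw (k : ℤ) (u : Fnl k) : ℂ := -fQ k u.1 / fP k u.1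

theorem norm_fw (k : ℤ) (u : Fnl k) : ‖fw k u‖ < 1 := by
  rw [fw, norm_div, norm_neg, div_lt_one (norm_pos_iff.2 (fP_ne k u))]
  exact u.2

/-- Coordinates of the coherent vector attached to a functional. -/
def cohFun (k : ℤ) (hk : k ≠ 0) (u : Fnl k) (m : KType k) : ℂ :=
  (Real.sqrt (binom k ((typeEquiv k hk).symm m)) : ℂ) * ((fP k u.1) ^ (k.natAbs + 1))⁻¹ *
    fw k u ^ ((typeEquiv k hk).symm m)

theorem hasSum_coh (k : ℤ) (hk : k ≠ 0) (u v : Fnl k) :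
    HasSum (fun m => conj (cohFun k hk u m) * cohFun k hk v m)
      ((herm k u.1 v.1 ^ (k.natAbs + 1))⁻¹) := by
  rw [← (typeEquiv k hk).hasSum_iff]
  have hw : ‖conj (fw k u) * fw k v‖ < 1 := by
    rw [norm_mul, RCLike.norm_conj]
    exact mul_lt_one_of_nonneg_of_lt_one_left (norm_nonneg _) (norm_fw k u) (norm_fw k v).le
  have h := (hasSum_binom k hw).mul_left
    ((conj (fP k u.1) ^ (k.natAbs + 1))⁻¹ * ((fP k v.1) ^ (k.natAbs + 1))⁻¹)
  have hP := fP_ne k u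
  have hP' := fP_ne k v
  have hPc : conj (fP k u.1) ≠ 0 := by simpa using hP
  have hh : herm k u.1 v.1 = conj (fP k u.1) * fP k v.1 * (1 - conj (fw k u) * fw k v) := by
    rw [herm, fw, fw, map_div₀, map_neg]
    field_simp
  rw [hh, mul_pow, mul_pow, mul_inv, mul_inv]
  convert! h using 1
  funext j
  simp only [Function.comp, cohFun, Equiv.symm_apply_apply, map_mul, map_inv₀, map_pow,
    Complex.conj_ofReal]
  have hb : (Real.sqrt (binom k j) : ℂ) * Real.sqrt (binom k j) = binom k j := by
    rw [← Complex.ofReal_mul, Real.mul_self_sqrt (binom_pos k j).le]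
  rw [← hb, mul_pow]
  ring

theorem memlp_coh (k : ℤ) (hk : k ≠ 0) (u : Fnl k) : Memℓp (cohFun k hk u) 2 := by
  rw [memℓp_gen_iff (by norm_num)]
  have h := (hasSum_coh k hk u u).summable.norm
  refine h.congr fun m => ?_
  simp [sq]

/-- The coherent vector attached to a functional. -/
def coh (k : ℤ) (hk : k ≠ 0) (u : Fnl k) : H k := ⟨cohFun k hk u, memlp_coh k hk u⟩

theorem coh_apply (k : ℤ) (hk : k ≠ 0) (u : Fnl k) (m : KType k) :
    coh k hk u m = cohFun k hk u m := rfl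

theorem inner_coh (k : ℤ) (hk : k ≠ 0) (u v : Fnl k) :
    inner ℂ (coh k hk u) (coh k hk v) = (herm k u.1 v.1 ^ (k.natAbs + 1))⁻¹ := by
  rw [lp.inner_eq_tsum, ← (hasSum_coh k hk u v).tsum_eq]
  refine tsum_congr fun m => ?_
  rw [RCLike.inner_apply, mul_comm]
  rfl

/-- The functional with `P = 1` and `Q = -w`. -/
def preFnl (k : ℤ) (w : ℂ) : ℂ × ℂ := (1 - w, -I * k.sign * (1 + w))

theorem fP_preFnl (k : ℤ) (hk : k ≠ 0) (w : ℂ) : fP k (preFnl k w) = 1 := by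
  simp only [fP, preFnl]
  linear_combination (-(1 + w) / 2 * I ^ 2) * sign_sq k hk - (1 + w) / 2 * I_sq

theorem fQ_preFnl (k : ℤ) (hk : k ≠ 0) (w : ℂ) : fQ k (preFnl k w) = -w := by
  simp only [fQ, preFnl]
  linear_combination ((1 + w) / 2 * I ^ 2) * sign_sq k hk + (1 + w) / 2 * I_sq

def fnlOf (k : ℤ) (hk : k ≠ 0) (w : ℂ) (hw : ‖w‖ < 1) : Fnl k :=
  ⟨preFnl k w, by rw [fP_preFnl k hk, fQ_preFnl k hk]; simpa using hw⟩

theorem cohFun_fnlOf (k : ℤ) (hk : k ≠ 0) (w : ℂ) (hw : ‖w‖ < 1) (m : KType k) :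
    cohFun k hk (fnlOf k hk w hw) m =
      (Real.sqrt (binom k ((typeEquiv k hk).symm m)) : ℂ) * w ^ ((typeEquiv k hk).symm m) := by
  simp [cohFun, fw, fnlOf, fP_preFnl k hk, fQ_preFnl k hk]

theorem hasSum_coh_fnlOf (k : ℤ) (hk : k ≠ 0) (w : ℂ) (hw : ‖w‖ < 1) :
    HasSum (fun j => ((Real.sqrt (binom k j) : ℂ) * w ^ j) • basisVec k (typeEquiv k hk j))
      (coh k hk (fnlOf k hk w hw)) := by
  classical
  have h := lp.hasSum_single (p := 2) (by norm_num) (coh k hk (fnlOf k hk w hw))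
  rw [← (typeEquiv k hk).hasSum_iff] at h
  convert! h using 1
  funext j
  simp only [Function.comp, coh_apply, cohFun_fnlOf, Equiv.symm_apply_apply, basisVec]
  rw [← lp.single_smul, smul_eq_mul, mul_one]

theorem inner_basisVec (k : ℤ) (m : KType k) (f : H k) : inner ℂ (basisVec k m) f = f m := by
  classical
  have := lp.inner_single_left (𝕜 := ℂ) m (1 : ℂ) f
  unfold basisVec
  convert! this using 1
  simp

theorem dense_coh (k : ℤ) (hk : k ≠ 0) :
    Dense (Submodule.span ℂ (Set.range (coh k hk)) : Set (H k)) := by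
  rw [Submodule.dense_iff_topologicalClosure_eq_top, Submodule.topologicalClosure_eq_top_iff,
    Submodule.eq_bot_iff]
  intro v hv
  have h0 : ∀ w : ℂ, ‖w‖ < 1 →
      HasSum (fun j => ((Real.sqrt (binom k j) : ℂ) * inner ℂ v (basisVec k (typeEquiv k hk j)))
        * w ^ j) 0 := by
    intro w hw
    have h1 := (hasSum_coh_fnlOf k hk w hw).mapL (innerSL ℂ v)
    have h2 : inner ℂ v (coh k hk (fnlOf k hk w hw)) = 0 :=
      Submodule.inner_left_of_mem_orthogonal (Submodule.subset_span (Set.mem_range_self _)) hv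
    simp only [innerSL_apply_apply, inner_smul_right, h2] at h1
    convert! h1 using 1
    funext j
    ring
  have h3 := coeff_unique (b := fun _ => 0) (f := fun _ => 0) h0
    (fun w _ => by simp)
  ext m
  obtain ⟨j, rfl⟩ := (typeEquiv k hk).surjective m
  have h4 := congrFun h3 j
  have h5 : (Real.sqrt (binom k j) : ℂ) ≠ 0 := by
    exact_mod_cast (Real.sqrt_pos.2 (binom_pos k j)).ne'
  rw [mul_eq_zero, or_iff_right h5, inner_eq_zero_symm, inner_basisVec] at h4
  simpa using h4

theorem continuous_inv_entry (i j : Fin 2) : Continuous fun x : G => (x⁻¹ i j : ℝ) := by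
  have h : Continuous fun x : G => ((x⁻¹ : G) : Matrix (Fin 2) (Fin 2) ℝ) :=
    continuous_subtype_val.comp continuous_inv
  exact h.matrix_elem i j

theorem exists_rep_coh (k : ℤ) (hk : k ≠ 0) :
    ∃ π : UnitaryRep G (H k), ∀ x u, π.toHom x (coh k hk u) = coh k hk (x • u) := by
  refine exists_rep (coh k hk) (dense_coh k hk) ?_ ?_
  · intro x u v
    rw [inner_coh, inner_coh, coe_smul, coe_smul, herm_act]
  · intro u v
    simp_rw [inner_coh, coe_smul]
    refine Continuous.inv₀ (Continuous.pow ?_ _) ?_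
    · have h := continuous_inv_entry
      simp only [herm_eq, act]
      have h00 := h 0 0
      have h01 := h 0 1
      have h10 := h 1 0
      have h11 := h 1 1
      fun_prop
    · intro x
      have h1 := fP_ne k u
      have h2 := fP_ne k (x • v)
      have h3 := u.2
      have h4 := (x • v).2
      rw [coe_smul] at h2 h4
      refine pow_ne_zero _ ?_
      rw [herm, sub_ne_zero]
      intro h
      have h5 := congrArg norm h
      rw [norm_mul, norm_mul, RCLike.norm_conj, RCLike.norm_conj] at h5
      exact (mul_lt_mul'' h3 h4 (norm_nonneg _) (norm_nonneg _)).ne' h5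

/-- The coordinate `ζ = v₁ + i ε v₂` of the first column of `g`. -/
def zeta (k : ℤ) (g : G) : ℂ := (g 0 0 : ℂ) + I * (k.sign : ℂ) * (g 1 0 : ℂ)

theorem conj_zeta (k : ℤ) (g : G) :
    conj (zeta k g) = (g 0 0 : ℂ) - I * (k.sign : ℂ) * (g 1 0 : ℂ) := by
  simp only [zeta, map_add, map_mul, conj_I, map_intCast, Complex.conj_ofReal]
  ring

theorem ell_eq (k : ℤ) (hk : k ≠ 0) (u : ℂ × ℂ) (g : G) :
    ell u g = fP k u * conj (zeta k g) + fQ k u * zeta k g := by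
  rw [conj_zeta]
  simp only [ell, fP, fQ, zeta]
  linear_combination (I ^ 2 * u.2 * (g 1 0 : ℂ)) * sign_sq k hk + u.2 * (g 1 0 : ℂ) * I_sq

theorem col_ne (g : G) : (g 0 0 : ℂ) - I * (g 1 0 : ℂ) ≠ 0 := by
  intro h
  have h1 := congrArg Complex.re h
  have h2 := congrArg Complex.im h
  simp at h1 h2
  have := det_entries g
  rw [h1, h2] at this
  norm_num at this

theorem coe_rotK_inv (θ : ℝ) : ((rotK θ)⁻¹ : K) = rotK (-θ) := by
  rw [inv_eq_iff_mul_eq_one]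
  apply Subtype.ext
  change rot θ * rot (-θ) = 1
  rw [← rot_add, add_neg_cancel, rot_zero]

theorem e_rotK (n : ℤ) (θ : ℝ) : e n (rotK θ) = Complex.exp (n * (θ * I)) := by
  rw [Complex.exp_int_mul, Complex.exp_mul_I]
  change ((Real.cos θ : ℝ) - I * (-Real.sin θ : ℝ) : ℂ) ^ n = _
  push_cast
  congr 1
  ring

theorem principalSeries_aux (k : ℤ) (hk : k ≠ 0) (j : ℕ) (g : G) :
    Complex.exp ((I * (I * (|k| : ℤ)) - 1) * (iwasawaH g : ℂ)) *
      e (typeEquiv k hk j : KType k) (iwasawaK g)⁻¹ =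
    zeta k g ^ j * (conj (zeta k g) ^ (k.natAbs + 1 + j))⁻¹ := by
  set z : ℂ := (g 0 0 : ℂ) - I * (g 1 0 : ℂ) with hz
  have hz0 : z ≠ 0 := col_ne g
  set r : ℝ := ‖z‖ with hr
  have hr0 : 0 < r := norm_pos_iff.2 hz0
  have hrc : (r : ℂ) ≠ 0 := by exact_mod_cast hr0.ne'
  have hr2 : g 0 0 ^ 2 + g 1 0 ^ 2 = r ^ 2 := by
    rw [hr, ← Complex.normSq_eq_norm_sq, Complex.normSq_apply]
    simp [hz]
    ring
  have h1 : Complex.exp ((I * (I * (|k| : ℤ)) - 1) * (iwasawaH g : ℂ)) =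
      ((r : ℂ) ^ (k.natAbs + 1))⁻¹ := by
    have hH : iwasawaH g = Real.log r := by
      rw [iwasawaH, hr2, Real.log_pow]; push_cast; ring
    have hk' : ((|k| : ℤ) : ℂ) = (k.natAbs : ℂ) := by
      rw [Int.abs_eq_natAbs, Int.cast_natCast]
    have h3 : (I * (I * (|k| : ℤ)) - 1) * (iwasawaH g : ℂ) =
        -(((k.natAbs + 1 : ℕ) : ℂ) * (Real.log r : ℂ)) := by
      rw [hH, hk']
      push_cast
      linear_combination (k.natAbs : ℂ) * (Real.log r : ℂ) * I_sq
    rw [h3, Complex.exp_neg, Complex.exp_nat_mul, ← Complex.ofReal_exp, Real.exp_log hr0]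
  set E : ℂ := Complex.exp (z.arg * I) with hE
  have hE0 : E ≠ 0 := Complex.exp_ne_zero _
  have hzE : z = r * E := (Complex.norm_mul_exp_arg_mul_I z).symm
  have hEc : conj E = E⁻¹ := by
    rw [hE, ← Complex.exp_conj, ← Complex.exp_neg]
    simp
  have hzc : (g 0 0 : ℂ) + I * (g 1 0 : ℂ) = r * E⁻¹ := by
    have := congrArg conj hzE
    rw [map_mul, hEc, Complex.conj_ofReal] at this
    rw [← this, hz]
    simp
  have h2 : e (typeEquiv k hk j : KType k) (iwasawaK g)⁻¹ =
      E ^ (-((typeEquiv k hk j : KType k) : ℤ)) := by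
    rw [iwasawaK, coe_rotK_inv, e_rotK, hE, ← Complex.exp_int_mul]
    congr 1
    push_cast
    ring
  rw [h1, h2]
  rcases lt_or_gt_of_ne hk with h | h
  · have hs : zeta k g = r * E := by
      rw [← hzE, hz, zeta, Int.sign_eq_neg_one_of_neg h]; push_cast; ring
    have hn : -((typeEquiv k hk j : KType k) : ℤ) = ((k.natAbs + 1 + j + j : ℕ) : ℤ) := by
      simp only [typeEquiv, Equiv.coe_fn_mk, Int.sign_eq_neg_one_of_neg h]; omega
    rw [hs, hn, zpow_natCast, map_mul, hEc, Complex.conj_ofReal, mul_pow, mul_pow,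
      inv_pow, mul_inv, inv_inv, pow_add E, pow_add E, pow_add (r : ℂ)]
    field_simp
    ring
  · have hs : zeta k g = r * E⁻¹ := by
      rw [← hzc, zeta, Int.sign_eq_one_of_pos h]; push_cast; ring
    have hn : -((typeEquiv k hk j : KType k) : ℤ) = -((k.natAbs + 1 + j + j : ℕ) : ℤ) := by
      simp only [typeEquiv, Equiv.coe_fn_mk, Int.sign_eq_one_of_pos h]; omega
    rw [hs, hn, zpow_neg, zpow_natCast, map_mul, map_inv₀, hEc, Complex.conj_ofReal, mul_pow, mul_pow,
      inv_pow, inv_inv, mul_inv, pow_add E, pow_add E, pow_add (r : ℂ)]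
    field_simp
    ring

theorem principalSeries_e (k : ℤ) (hk : k ≠ 0) (j : ℕ) (x : G) (θ : ℝ) :
    principalSeries (I * (|k| : ℤ)) x (e (typeEquiv k hk j : KType k)) (rotK θ) =
    zeta k (x⁻¹ * rot (-θ)) ^ j * (conj (zeta k (x⁻¹ * rot (-θ))) ^ (k.natAbs + 1 + j))⁻¹ := by
  have h : ((rotK θ : K) : G)⁻¹ = rot (-θ) := congrArg Subtype.val (coe_rotK_inv θ)
  rw [principalSeries, h]
  exact principalSeries_aux k hk j _

theorem zeta_ne (k : ℤ) (hk : k ≠ 0) (g : G) : zeta k g ≠ 0 := by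
  rcases lt_or_gt_of_ne hk with h | h
  · rw [zeta, Int.sign_eq_neg_one_of_neg h]
    convert! col_ne g using 1
    push_cast; ring
  · have h1 : conj (zeta k g) ≠ 0 := by
      rw [conj_zeta, Int.sign_eq_one_of_pos h]
      convert! col_ne g using 1
      push_cast; ring
    simpa using h1

theorem hasSum_ell (k : ℤ) (hk : k ≠ 0) (u : Fnl k) (g : G) :
    HasSum (fun j => (binom k j : ℂ) * ((fP k u.1) ^ (k.natAbs + 1))⁻¹ * fw k u ^ j *
      (zeta k g ^ j * (conj (zeta k g) ^ (k.natAbs + 1 + j))⁻¹))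
      ((ell u.1 g ^ (k.natAbs + 1))⁻¹) := by
  have hz := zeta_ne k hk g
  have hzc : conj (zeta k g) ≠ 0 := by simpa using hz
  have hP := fP_ne k u
  have hw : ‖fw k u * (zeta k g / conj (zeta k g))‖ < 1 := by
    rw [norm_mul, norm_div, RCLike.norm_conj, div_self (norm_ne_zero_iff.2 hz), mul_one]
    exact norm_fw k u
  have h := (hasSum_binom k hw).mul_left
    (((fP k u.1) ^ (k.natAbs + 1))⁻¹ * (conj (zeta k g) ^ (k.natAbs + 1))⁻¹)
  have he : ell u.1 g = fP k u.1 * conj (zeta k g) *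
      (1 - fw k u * (zeta k g / conj (zeta k g))) := by
    rw [ell_eq k hk, fw]
    field_simp
    ring
  rw [he, mul_pow, mul_pow, mul_inv, mul_inv]
  convert! h using 1
  funext j
  rw [mul_pow, div_pow, pow_add _ (k.natAbs + 1) j, mul_inv]
  ring

theorem continuous_zeta (k : ℤ) (x : G) : Continuous fun θ : ℝ => zeta k (x * rot (-θ)) := by
  simp only [zeta, mul_apply_two, coe_rot]
  simp
  fun_prop

theorem hasSum_innerL2K (k : ℤ) (hk : k ≠ 0) (u : Fnl k) (x : G) (m : ℤ) :
    HasSum (fun j => (binom k j : ℂ) * ((fP k u.1) ^ (k.natAbs + 1))⁻¹ * fw k u ^ j *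
      innerL2K (principalSeries (I * (|k| : ℤ)) x (e (typeEquiv k hk j : KType k))) (e m))
      ((2 * Real.pi : ℂ)⁻¹ * ∫ θ in (0 : ℝ)..(2 * Real.pi),
        (ell u.1 (x⁻¹ * rot (-θ)) ^ (k.natAbs + 1))⁻¹ * conj (e m (rotK θ))) := by
  have hne : ∀ m : ℤ, ∀ θ : ℝ, ‖e m (rotK θ)‖ = 1 := by
    intro m θ
    rw [e_rotK, ← mul_assoc]
    exact_mod_cast Complex.norm_exp_ofReal_mul_I (m * θ)
  have hcont := continuous_zeta k x⁻¹
  have hcconj : Continuous fun θ : ℝ => conj (zeta k (x⁻¹ * rot (-θ))) :=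
    Complex.continuous_conj.comp hcont
  have hconj0 : ∀ θ : ℝ, conj (zeta k (x⁻¹ * rot (-θ))) ≠ 0 := fun θ => by
    simpa using zeta_ne k hk _
  have hce : Continuous fun θ : ℝ => conj (e m (rotK θ)) := by
    refine Complex.continuous_conj.comp ?_
    simp only [e_rotK]
    fun_prop
  have hI := intervalIntegral.hasSum_integral_of_dominated_convergence (μ := volume)
    (a := 0) (b := 2 * Real.pi) (ι := ℕ)
    (F := fun j θ => ((binom k j : ℂ) * ((fP k u.1) ^ (k.natAbs + 1))⁻¹ * fw k u ^ j *
      (zeta k (x⁻¹ * rot (-θ)) ^ j * (conj (zeta k (x⁻¹ * rot (-θ))) ^ (k.natAbs + 1 + j))⁻¹)) *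
      conj (e m (rotK θ)))
    (f := fun θ => (ell u.1 (x⁻¹ * rot (-θ)) ^ (k.natAbs + 1))⁻¹ * conj (e m (rotK θ)))
    (fun j θ => ‖(binom k j : ℂ) * fw k u ^ j‖ * (‖((fP k u.1) ^ (k.natAbs + 1))⁻¹‖ *
      (‖zeta k (x⁻¹ * rot (-θ))‖ ^ (k.natAbs + 1))⁻¹))
    ?_ ?_ ?_ ?_ ?_
  · have h2 := hI.mul_left ((2 * Real.pi : ℂ)⁻¹)
    convert! h2 using 1
    funext j
    simp only [innerL2K, principalSeries_e]
    rw [← intervalIntegral.integral_const_mul, ← intervalIntegral.integral_const_mul,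
      ← intervalIntegral.integral_const_mul]
    congr 1
    funext θ
    ring
  · intro j
    refine Continuous.aestronglyMeasurable ?_
    refine ((continuous_const.mul ((hcont.pow j).mul ?_))).mul hce
    exact (hcconj.pow _).inv₀ fun θ => pow_ne_zero _ (hconj0 θ)
  · intro j
    refine Filter.Eventually.of_forall fun θ _ => le_of_eq ?_
    have hz : ‖zeta k (x⁻¹ * rot (-θ))‖ ≠ 0 := norm_ne_zero_iff.2 (zeta_ne k hk _)
    simp only [norm_mul, RCLike.norm_conj, hne, norm_inv, norm_pow]
    field_simp
    ring
  · exact Filter.Eventually.of_forall fun θ _ =>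
      (hasSum_binom k (norm_fw k u)).summable.norm.mul_right _
  · refine Continuous.intervalIntegrable ?_ _ _
    simp_rw [tsum_mul_right]
    refine continuous_const.mul (continuous_const.mul ?_)
    exact (hcont.norm.pow _).inv₀ fun θ =>
      pow_ne_zero _ (norm_ne_zero_iff.2 (zeta_ne k hk _))
  · exact Filter.Eventually.of_forall fun θ _ => (hasSum_ell k hk u _).mul_right _

theorem principalSeries_one_e (k : ℤ) (hk : k ≠ 0) (n : KType k) (θ : ℝ) :
    principalSeries (I * (|k| : ℤ)) 1 (e n) (rotK θ) = e n (rotK θ) := by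
  obtain ⟨j, rfl⟩ := (typeEquiv k hk).surjective n
  have hz : zeta k (1⁻¹ * rot (-θ)) = Complex.exp ((k.sign : ℂ) * (θ * I)) := by
    rw [inv_one, one_mul, zeta, coe_rot]
    rcases lt_or_gt_of_ne hk with h | h
    · rw [Int.sign_eq_neg_one_of_neg h]
      push_cast
      rw [neg_one_mul, ← neg_mul, Complex.exp_mul_I]
      simp [mul_comm]
    · rw [Int.sign_eq_one_of_pos h]
      push_cast
      rw [one_mul, Complex.exp_mul_I]
      simp [mul_comm]
  have hzc : conj (zeta k (1⁻¹ * rot (-θ))) = Complex.exp (-((k.sign : ℂ) * (θ * I))) := by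
    rw [hz, ← Complex.exp_conj]
    simp
  rw [principalSeries_e k hk, hzc, hz, ← Complex.exp_nat_mul, ← Complex.exp_nat_mul,
    ← Complex.exp_neg, ← Complex.exp_add, e_rotK]
  congr 1
  have hj : ((typeEquiv k hk j : KType k) : ℤ) = k.sign * ((k.natAbs + 1 + 2 * j : ℕ) : ℤ) := by
    rcases lt_or_gt_of_ne hk with h | h
    · simp only [typeEquiv, Equiv.coe_fn_mk, Int.sign_eq_neg_one_of_neg h]; omega
    · simp only [typeEquiv, Equiv.coe_fn_mk, Int.sign_eq_one_of_pos h]; omega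
  rw [hj]
  generalize k.natAbs = s
  push_cast
  ring

theorem integral_exp_int (n : ℤ) (hn : n ≠ 0) :
    ∫ θ in (0 : ℝ)..(2 * Real.pi), Complex.exp ((n * I) * θ) = 0 := by
  have hc : (n : ℂ) * I ≠ 0 := mul_ne_zero (by exact_mod_cast hn) I_ne_zero
  rw [integral_exp_mul_complex hc]
  have : Complex.exp ((n * I) * ((2 * Real.pi : ℝ) : ℂ)) = 1 := by
    rw [Complex.exp_eq_one_iff]
    exact ⟨n, by push_cast; ring⟩
  rw [this]
  simp

theorem principalSeries_one (k : ℤ) (hk : k ≠ 0) (n m : KType k) :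
    innerL2K (principalSeries (I * (|k| : ℤ)) 1 (e n)) (e m) = if n = m then 1 else 0 := by
  have h : ∀ θ : ℝ, principalSeries (I * (|k| : ℤ)) 1 (e n) (rotK θ) * conj (e m (rotK θ)) =
      Complex.exp ((((n : ℤ) - (m : ℤ) : ℤ) * I) * θ) := by
    intro θ
    rw [principalSeries_one_e k hk, e_rotK, e_rotK, ← Complex.exp_conj, ← Complex.exp_add]
    congr 1
    simp
    ring
  simp only [innerL2K, h]
  split_ifs with hnm
  · subst hnm
    simp
    field_simp
  · rw [integral_exp_int _ (sub_ne_zero.2 fun h => hnm (Subtype.ext h)), mul_zero]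

theorem coh_coord (k : ℤ) (hk : k ≠ 0) (u : Fnl k) (m : KType k) :
    coh k hk u m = (Real.sqrt (renormSq k m) : ℂ) * ((2 * Real.pi : ℂ)⁻¹ *
      ∫ θ in (0 : ℝ)..(2 * Real.pi),
        (ell u.1 (rot (-θ)) ^ (k.natAbs + 1))⁻¹ * conj (e m (rotK θ))) := by
  have h := hasSum_innerL2K k hk u 1 m
  simp only [principalSeries_one k hk, inv_one, one_mul] at h
  obtain ⟨l, rfl⟩ := (typeEquiv k hk).surjective m
  have h2 : ∀ j, j ≠ l → (binom k j : ℂ) * ((fP k u.1) ^ (k.natAbs + 1))⁻¹ * fw k u ^ j *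
      (if typeEquiv k hk j = typeEquiv k hk l then (1 : ℂ) else 0) = 0 := by
    intro j hj
    rw [if_neg (fun h => hj ((typeEquiv k hk).injective h)), mul_zero]
  rw [h.unique (hasSum_single l h2), if_pos rfl, coh_apply, cohFun, renormSq_typeEquiv,
    Equiv.symm_apply_apply]
  have hb := binom_pos k l
  have hb' : ((Real.sqrt (binom k l)⁻¹ : ℝ) : ℂ) * binom k l = Real.sqrt (binom k l) := by
    rw [← Complex.ofReal_mul]
    congr 1
    rw [Real.sqrt_inv, inv_mul_eq_div, Real.div_sqrt]
  rw [← hb']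
  ring

/-- The subrepresentation of the principal series defining the discrete series exists. -/
theorem exists_isDiscreteSeries (k : ℤ) (hk : k ≠ 0) : ∃ π, IsDiscreteSeries k π := by
  obtain ⟨π, hπ⟩ := exists_rep_coh k hk
  refine ⟨π, fun x n m => ?_⟩
  obtain ⟨l, rfl⟩ := (typeEquiv k hk).surjective n
  have hA : ∀ w : ℂ, ‖w‖ < 1 → HasSum (fun j => ((Real.sqrt (binom k j) : ℂ) *
      π.matrixCoeff (basisVec k (typeEquiv k hk j)) (basisVec k m) x) * w ^ j)
      (if hw : ‖w‖ < 1 then coh k hk (x • fnlOf k hk w hw) m else 0) := by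
    intro w hw
    have h1 := (hasSum_coh_fnlOf k hk w hw).mapL
      ((innerSL ℂ (basisVec k m)).comp (π.toHom x : H k →L[ℂ] H k))
    rw [dif_pos hw, ← inner_basisVec, ← hπ]
    convert! h1 using 1
    funext j
    simp [UnitaryRep.matrixCoeff]
    ring
  have hB : ∀ w : ℂ, ‖w‖ < 1 → HasSum (fun j => ((Real.sqrt (renormSq k m) : ℂ) *
      ((binom k j : ℂ) *
      innerL2K (principalSeries (I * (|k| : ℤ)) x (e (typeEquiv k hk j : KType k))) (e m))) * w ^ j)
      (if hw : ‖w‖ < 1 then coh k hk (x • fnlOf k hk w hw) m else 0) := by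
    intro w hw
    have h1 := (hasSum_innerL2K k hk (fnlOf k hk w hw) x m).mul_left
      (Real.sqrt (renormSq k m) : ℂ)
    rw [dif_pos hw, coh_coord]
    simp only [coe_smul, ell_act]
    convert! h1 using 1
    funext j
    simp only [fw, fnlOf, fP_preFnl k hk, fQ_preFnl k hk]
    simp
    ring
  have h := congrFun (coeff_unique hA hB) l
  have hb := Real.sqrt_pos.2 (binom_pos k l)
  have hbc : (Real.sqrt (binom k l) : ℂ) ≠ 0 := by exact_mod_cast hb.ne'
  have hbb : (binom k l : ℂ) = Real.sqrt (binom k l) * Real.sqrt (binom k l) := by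
    rw [← Complex.ofReal_mul, Real.mul_self_sqrt (binom_pos k l).le]
  refine mul_left_cancel₀ hbc (h.trans ?_)
  have hm : 0 ≤ renormSq k m := by unfold renormSq; positivity
  rw [renormSq_typeEquiv, div_inv_eq_mul, Real.sqrt_mul hm, hbb]
  push_cast
  ring

/-- The matrix entries determine the representation. -/
theorem isDiscreteSeries_unique (k : ℤ) (π ρ : UnitaryRep G (H k))
    (h : IsDiscreteSeries k π) (h' : IsDiscreteSeries k ρ) (x : G) (v : H k) :
    π.toHom x v = ρ.toHom x v := by
  classical
  have h1 : ∀ n : KType k, π.toHom x (basisVec k n) = ρ.toHom x (basisVec k n) := by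
    intro n
    ext m
    rw [← inner_basisVec, ← inner_basisVec]
    exact (h x n m).trans (h' x n m).symm
  have h2 := lp.hasSum_single (p := 2) (by norm_num) v
  have h3 : ∀ m : KType k, lp.single 2 m (v m) = v m • basisVec k m := by
    intro m
    simp only [basisVec]
    rw [← lp.single_smul, smul_eq_mul, mul_one]
  simp only [h3] at h2
  have h4 := h2.mapL (π.toHom x : H k →L[ℂ] H k)
  have h5 := h2.mapL (ρ.toHom x : H k →L[ℂ] H k)
  refine h4.unique ?_
  convert! h5 using 1
  funext m
  simp [h1]

/-- The discrete series representation `(π_{ik}, H_k)`, `k ≠ 0`: the unique unitary representation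
on `H_k` with the renormalized matrix entries of `π_{τ, i|k|}`. -/
def discreteSeries (k : ℤ) (hk : k ≠ 0) : UnitaryRep G (H k) :=
  Classical.choose (exists_isDiscreteSeries k hk)

/-- Membership of (the equivalence class of) a representation in `E_{p,∞}(G)`: it is
irreducible, and all its `K`-finite matrix coefficients, that is, all `x ↦ ⟨π(x) u, v⟩` with
`K`-finite `u` and `v`, lie in `L^{p,∞}(G)`. -/
structure MemEpInfty [MeasurableSpace G] (p : ℝ) (μ : Measure G)
    {V : Type*} [NormedAddCommGroup V] [InnerProductSpace ℂ V] (π : UnitaryRep G V) : Prop where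
  irreducible : π.IsIrreducible
  coeff : ∀ u v : V, π.IsKFinite K u → π.IsKFinite K v → MemWeakLp (π.matrixCoeff u v) p μ

end SL2R

end

namespace SL2R

/-! ### The discrete series on coherent vectors and on `K`-types -/

/-! Put n = |k| + 1 and ‖x‖² = `normSqHS x`. The coherent vectors `coh k hk u` have Gram kernel
`herm k u v ^ (-n)`, and the representation permutes them through the linear action on functionals
(`toHom_coh`). Hence the coefficient of the basis vector of extremal K-type has modulus exactly
`decay k x` = ((‖x‖² + 2) / 4)^(-n/2) (`norm_matrixCoeff_lowest`). Coherent vectors generate the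
other coefficients as Taylor coefficients, so Cauchy's estimates bound those by a multiple of `decay
k x` (`norm_matrixCoeff_basisVec_le`). K-finite vectors are finite combinations of basis vectors, so
the bound covers every K-finite coefficient.

The ball ‖x‖ ≤ R has Haar measure of order R² (`measure_normSqHS_le`, `le_measure_normSqHS_le`).
Thus {decay > α} is empty for α ≥ 1 and has measure of order α^(-2/n) as α → 0. Multiplied by α^p
this stays bounded exactly when p n ≥ 2, that is, |k| ≥ 2/p - 1. Irreducibility holds for every k ≠
0: the K-types are simple, and the orbit of the extremal vector is orthogonal to none of them. -/

theorem hasSum_smul_basisVec (k : ℤ) (v : H k) : HasSum (fun m => v m • basisVec k m) v := by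
  classical
  have h := lp.hasSum_single (p := 2) (by norm_num) v
  convert! h using 1
  funext m
  simp only [basisVec]
  rw [← lp.single_smul, smul_eq_mul, mul_one]

theorem hasSum_coh_basisVec (k : ℤ) (hk : k ≠ 0) (u : Fnl k) :
    HasSum (fun j => ((Real.sqrt (binom k j) : ℂ) * ((fP k u.1) ^ (k.natAbs + 1))⁻¹ *
      fw k u ^ j) • basisVec k (typeEquiv k hk j)) (coh k hk u) := by
  have h := hasSum_smul_basisVec k (coh k hk u)
  rw [← (typeEquiv k hk).hasSum_iff] at h
  convert! h using 1
  funext j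
  simp only [Function.comp, coh_apply, cohFun, Equiv.symm_apply_apply]

variable {k : ℤ} {π : UnitaryRep G (H k)}

/-- Only matrix entries are prescribed, so both sides are compared coordinatewise. Summing the
entries over the coherent expansion gives the series of `hasSum_innerL2K`, whose integrand is the
functional `x • u` in disguise by `ell_act`. -/
theorem IsDiscreteSeries.toHom_coh (h : IsDiscreteSeries k π) (hk : k ≠ 0) (x : G) (u : Fnl k) :
    π.toHom x (coh k hk u) = coh k hk (x • u) := by
  ext m
  rw [← inner_basisVec, coh_coord]
  have h1 := (hasSum_coh_basisVec k hk u).mapL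
    ((innerSL ℂ (basisVec k m)).comp (π.toHom x : H k →L[ℂ] H k))
  have h2 := (hasSum_innerL2K k hk u x m).mul_left (Real.sqrt (renormSq k m) : ℂ)
  simp only [coe_smul, ell_act]
  refine h1.unique ?_
  convert! h2 using 1
  funext j
  have hm : 0 ≤ renormSq k m := by unfold renormSq; positivity
  -- One square root comes from the coherent vector, the other from the renormalised norm of the
  -- K-type.
  have hbb : (binom k j : ℂ) = Real.sqrt (binom k j) * Real.sqrt (binom k j) := by
    rw [← Complex.ofReal_mul, Real.mul_self_sqrt (binom_pos k j).le]
  have h3 := h x (typeEquiv k hk j) m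
  rw [renormSq_typeEquiv, div_inv_eq_mul, Real.sqrt_mul hm] at h3
  simp only [UnitaryRep.matrixCoeff] at h3
  simp only [ContinuousLinearMap.comp_apply, map_smul, innerSL_apply_apply, smul_eq_mul]
  change _ * inner ℂ (basisVec k m) (π.toHom x (basisVec k (typeEquiv k hk j))) = _
  rw [h3, hbb]
  push_cast
  ring

/-- A rotation only shifts the angle of the argument. Keeping `principalSeries` at 1 on the right
lets `principalSeries_one` supply the orthogonality relations. -/
theorem principalSeries_rot_e (hk : k ≠ 0) (n : KType k) (θ φ : ℝ) :
    principalSeries (I * (|k| : ℤ)) (rot θ) (e n) (rotK φ) =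
      Complex.exp ((n : ℤ) * (θ * I)) * principalSeries (I * (|k| : ℤ)) 1 (e n) (rotK φ) := by
  have h : principalSeries (I * (|k| : ℤ)) (rot θ) (e n) (rotK φ) =
      principalSeries (I * (|k| : ℤ)) 1 (e n) (rotK (θ + φ)) := by
    obtain ⟨j, rfl⟩ := (typeEquiv k hk).surjective n
    have h1 : (rot θ)⁻¹ = rot (-θ) := by
      rw [inv_eq_iff_mul_eq_one, ← rot_add, add_neg_cancel, rot_zero]
    rw [principalSeries_e k hk, principalSeries_e k hk, h1, ← rot_add, inv_one, one_mul, neg_add]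
  rw [h, principalSeries_one_e k hk, principalSeries_one_e k hk, e_rotK, e_rotK,
    ← Complex.exp_add]
  congr 1
  push_cast
  ring

theorem IsDiscreteSeries.toHom_rot (h : IsDiscreteSeries k π) (hk : k ≠ 0) (θ : ℝ)
    (n : KType k) :
    π.toHom (rot θ) (basisVec k n) = Complex.exp ((n : ℤ) * (θ * I)) • basisVec k n := by
  have h1 : ∀ m, innerL2K (principalSeries (I * (|k| : ℤ)) (rot θ) (e n)) (e m) =
      Complex.exp ((n : ℤ) * (θ * I)) *
        innerL2K (principalSeries (I * (|k| : ℤ)) 1 (e n)) (e m) := by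
    intro m
    simp only [innerL2K, principalSeries_rot_e hk, mul_assoc]
    rw [intervalIntegral.integral_const_mul]
    ring
  have h2 : ∀ m : KType k, inner ℂ (basisVec k m) (basisVec k n) = if n = m then (1 : ℂ) else 0 := by
    classical
    intro m
    rw [inner_basisVec, basisVec, lp.single_apply]
    split_ifs with h3
    · subst h3
      exact Pi.single_eq_same ..
    · exact Pi.single_eq_of_ne (Ne.symm h3) _
  ext m
  rw [← inner_basisVec, ← inner_basisVec, inner_smul_right, h2]
  have h3 := h (rot θ) n m
  rw [UnitaryRep.matrixCoeff, h1, principalSeries_one k hk] at h3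
  rw [h3]
  split_ifs with hnm
  · subst hnm
    have h0 : renormSq k n ≠ 0 := by
      obtain ⟨j, rfl⟩ := (typeEquiv k hk).surjective n
      rw [renormSq_typeEquiv]
      exact inv_ne_zero (binom_pos k j).ne'
    rw [div_self h0]
    simp
  · simp

theorem _root_.UnitaryRep.inner_toHom_inv {Γ V : Type*} [Group Γ] [TopologicalSpace Γ]
    [NormedAddCommGroup V] [InnerProductSpace ℂ V] (ρ : UnitaryRep Γ V) (x : Γ) (u v : V) :
    inner ℂ (ρ.toHom x⁻¹ u) v = inner ℂ u (ρ.toHom x v) := by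
  have h : ρ.toHom x (ρ.toHom x⁻¹ u) = u := by
    change (ρ.toHom x * ρ.toHom x⁻¹) u = u
    rw [← map_mul, mul_inv_cancel, map_one]
    rfl
  rw [← LinearIsometryEquiv.inner_map_map (ρ.toHom x), h]

theorem IsDiscreteSeries.toHom_rot_apply (h : IsDiscreteSeries k π) (hk : k ≠ 0) (θ : ℝ)
    (v : H k) (m : KType k) :
    π.toHom (rot θ) v m = Complex.exp ((m : ℤ) * (θ * I)) * v m := by
  have h1 : (rot θ)⁻¹ = rot (-θ) := by
    rw [inv_eq_iff_mul_eq_one, ← rot_add, add_neg_cancel, rot_zero]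
  rw [← inner_basisVec, ← inner_basisVec, ← π.inner_toHom_inv, h1, h.toHom_rot hk,
    inner_smul_left, ← Complex.exp_conj]
  congr 2
  simp

/-- Since π is irrational, the rotation by one radian alone separates all K-types; no averaging over
K is needed later. -/
theorem exp_int_mul_I_injective :
    Function.Injective fun m : ℤ => Complex.exp (m * ((1 : ℝ) * I)) := by
  intro m n h
  obtain ⟨l, hl⟩ := Complex.exp_eq_exp_iff_exists_int.1 h
  have h1 : (m : ℝ) = n + l * (2 * Real.pi) := by
    have := congrArg Complex.im hl
    simpa using this
  by_contra hmn
  have hl0 : l ≠ 0 := by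
    rintro rfl
    refine hmn ?_
    simpa using h1
  refine irrational_pi ⟨(m - n) / (2 * l), ?_⟩
  have hl1 : (l : ℝ) ≠ 0 := by exact_mod_cast hl0
  push_cast
  field_simp
  linarith

/-! ### Irreducibility -/

theorem eq_top_of_basisVec_mem {W : Submodule ℂ (H k)} (hW : IsClosed (W : Set (H k)))
    (h : ∀ n, basisVec k n ∈ W) : W = ⊤ := by
  rw [eq_top_iff]
  intro v _
  refine hW.mem_of_tendsto (hasSum_smul_basisVec k v) (Filter.Eventually.of_forall fun s => ?_)
  exact W.sum_mem fun n _ => W.smul_mem _ (h n)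

theorem toHom_mem_orthogonal {W : Submodule ℂ (H k)}
    (hinv : ∀ x, ∀ w ∈ W, π.toHom x w ∈ W) (x : G) {v : H k} (hv : v ∈ Wᗮ) :
    π.toHom x v ∈ Wᗮ := by
  rw [Submodule.mem_orthogonal] at hv ⊢
  intro u hu
  rw [← π.inner_toHom_inv]
  exact hv _ (hinv _ u hu)

/-- Both W and its orthogonal complement are invariant, so the components of an eigenvector of `rot
1` are eigenvectors for the same eigenvalue. That eigenvalue is simple, so the W-component is a
multiple of the basis vector. -/
theorem IsDiscreteSeries.basisVec_mem_or (h : IsDiscreteSeries k π) (hk : k ≠ 0)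
    {W : Submodule ℂ (H k)} (hW : IsClosed (W : Set (H k)))
    (hinv : ∀ x, ∀ w ∈ W, π.toHom x w ∈ W) (n : KType k) :
    basisVec k n ∈ W ∨ basisVec k n ∈ Wᗮ := by
  have : CompleteSpace W := hW.completeSpace_coe
  obtain ⟨p, hp, q, hq, hpq⟩ := W.exists_add_mem_mem_orthogonal (basisVec k n)
  set c := Complex.exp ((n : ℤ) * ((1 : ℝ) * I)) with hc
  -- The left side lies in W and the right side in its complement, so both vanish.
  have h1 : π.toHom (rot 1) p - c • p = c • q - π.toHom (rot 1) q := by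
    have h2 := h.toHom_rot hk 1 n
    rw [← hc, hpq, map_add, smul_add] at h2
    rw [sub_eq_sub_iff_add_eq_add, h2, add_comm]
  have h3 : π.toHom (rot 1) p - c • p ∈ W := W.sub_mem (hinv _ _ hp) (W.smul_mem _ hp)
  have h4 : π.toHom (rot 1) p - c • p ∈ Wᗮ := by
    rw [h1]
    exact Wᗮ.sub_mem (Wᗮ.smul_mem _ hq) (toHom_mem_orthogonal hinv _ hq)
  have h5 : π.toHom (rot 1) p = c • p := by
    rw [← sub_eq_zero]
    exact (Submodule.disjoint_def.1 W.orthogonal_disjoint) _ h3 h4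
  have h6 : ∀ m, m ≠ n → p m = 0 := by
    intro m hm
    have h7 := h.toHom_rot_apply hk 1 p m
    rw [h5, lp.coeFn_smul, Pi.smul_apply, smul_eq_mul] at h7
    by_contra h8
    exact hm (Subtype.ext (exp_int_mul_I_injective (mul_right_cancel₀ h8 h7).symm))
  have h7 : p = p n • basisVec k n := by
    refine (hasSum_smul_basisVec k p).unique (hasSum_single n fun m hm => ?_)
    rw [h6 m hm, zero_smul]
  by_cases h8 : p n = 0
  · right
    rw [h8, zero_smul] at h7
    rwa [hpq, h7, zero_add]
  · left
    exact (W.smul_mem_iff h8).1 (h7 ▸ hp)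

theorem basisVec_zero_eq_coh (k : ℤ) (hk : k ≠ 0) :
    basisVec k (typeEquiv k hk 0) = coh k hk (fnlOf k hk 0 (by simp)) := by
  refine HasSum.unique ?_ (hasSum_coh_fnlOf k hk 0 (by simp))
  -- At the centre of the disc only j = 0 survives, with 0 ^ 0 = 1.
  have h := hasSum_single (f := fun j => ((Real.sqrt (binom k j) : ℂ) * 0 ^ j) •
    basisVec k (typeEquiv k hk j)) 0 fun j hj => by simp [hj]
  simpa [binom] using h

theorem inv_apply (x : G) : x⁻¹ 0 0 = x 1 1 ∧ x⁻¹ 0 1 = -x 0 1 ∧ x⁻¹ 1 0 = -x 1 0 ∧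
    x⁻¹ 1 1 = x 0 0 := by
  simp [Matrix.SpecialLinearGroup.coe_inv, Matrix.adjugate_fin_two]

/-- A coherent vector over a nonzero point of the disc has no vanishing coordinate. So one x that
moves the centre serves all n; diag(2, 1/2) moves it to 3/5. -/
theorem IsDiscreteSeries.exists_inner_ne_zero (h : IsDiscreteSeries k π) (hk : k ≠ 0)
    (n : KType k) :
    ∃ x, inner ℂ (basisVec k n) (π.toHom x (basisVec k (typeEquiv k hk 0))) ≠ 0 := by
  let x : G := ⟨!![2, 0; 0, 1 / 2], by norm_num [Matrix.det_fin_two_of]⟩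
  refine ⟨x, ?_⟩
  rw [basisVec_zero_eq_coh, h.toHom_coh hk, inner_basisVec, coh_apply, cohFun]
  have hP := fP_ne k (x • fnlOf k hk 0 (by simp))
  have hQ : fQ k (x • fnlOf k hk 0 (by simp)).1 ≠ 0 := by
    obtain ⟨h1, h2, h3, h4⟩ := inv_apply x
    rw [coe_smul]
    simp only [fQ, act, fnlOf, preFnl, h1, h2, h3, h4]
    have h5 : (1 - 0) * (((x 1 1 : ℝ) : ℂ)) + -I * (k.sign : ℂ) * (1 + 0) * (-x 1 0 : ℝ) -
        I * (k.sign : ℂ) * ((1 - 0) * (-x 0 1 : ℝ) + -I * (k.sign : ℂ) * (1 + 0) * (x 0 0 : ℝ)) =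
        -3 / 2 := by
      simp [x]
      linear_combination (2 * I ^ 2) * sign_sq k hk + 2 * I_sq
    rw [h5]
    norm_num
  refine mul_ne_zero (mul_ne_zero ?_ (inv_ne_zero (pow_ne_zero _ hP))) (pow_ne_zero _ ?_)
  · exact_mod_cast (Real.sqrt_pos.2 (binom_pos k _)).ne'
  · exact div_ne_zero (neg_ne_zero.2 hQ) hP

theorem IsDiscreteSeries.eq_top (h : IsDiscreteSeries k π) (hk : k ≠ 0)
    {W : Submodule ℂ (H k)} (hW : IsClosed (W : Set (H k)))
    (hinv : ∀ x, ∀ w ∈ W, π.toHom x w ∈ W) (h0 : basisVec k (typeEquiv k hk 0) ∈ W) :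
    W = ⊤ := by
  refine eq_top_of_basisVec_mem hW fun n => (h.basisVec_mem_or hk hW hinv n).resolve_right ?_
  intro hn
  obtain ⟨x, hx⟩ := h.exists_inner_ne_zero hk n
  exact hx (Submodule.inner_left_of_mem_orthogonal (hinv x _ h0) hn)

theorem IsDiscreteSeries.isIrreducible (h : IsDiscreteSeries k π) (hk : k ≠ 0) :
    π.IsIrreducible := by
  classical
  refine ⟨⟨basisVec k (typeEquiv k hk 0), 0, ?_⟩, fun W hW hinv => ?_⟩
  · intro h0
    have := congrArg (fun v : H k => v (typeEquiv k hk 0)) h0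
    simp [basisVec] at this
  · rcases h.basisVec_mem_or hk hW hinv (typeEquiv k hk 0) with h0 | h0
    · exact Or.inr (h.eq_top hk hW hinv h0)
    -- The complement of W is itself closed and invariant and contains the extremal vector, so it is
    -- everything.
    · left
      have : CompleteSpace W := hW.completeSpace_coe
      have h1 := h.eq_top hk W.isClosed_orthogonal (fun x w hw => toHom_mem_orthogonal hinv x hw) h0
      rwa [Submodule.orthogonal_eq_top_iff] at h1

/-! ### `K`-finite vectors -/

theorem IsDiscreteSeries.isKFinite_basisVec (h : IsDiscreteSeries k π) (hk : k ≠ 0)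
    (n : KType k) : π.IsKFinite K (basisVec k n) := by
  refine Submodule.finiteDimensional_of_le
    (S₂ := Submodule.span ℂ ({basisVec k n} : Set (H k))) ?_
  rw [Submodule.span_le]
  rintro _ ⟨⟨_, θ, rfl⟩, rfl⟩
  change π.toHom (rot θ) (basisVec k n) ∈ _
  rw [h.toHom_rot hk]
  exact Submodule.smul_mem _ _ (Submodule.mem_span_singleton_self _)

/-- The iterates of `rot 1` on v are linearly dependent, which gives a nonzero polynomial q with
q(e^{im}) v_m = 0 for all m. As q has finitely many roots and the e^{im} are distinct, v has finite
support. -/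
theorem IsDiscreteSeries.mem_span_of_isKFinite (h : IsDiscreteSeries k π) (hk : k ≠ 0)
    {v : H k} (hv : π.IsKFinite K v) : v ∈ Submodule.span ℂ (Set.range (basisVec k)) := by
  set F := Submodule.span ℂ (Set.range fun κ : K => π.toHom (κ : G) v) with hF
  have : FiniteDimensional ℂ F := hv
  let w : ℕ → F := fun j => ⟨π.toHom (rot j) v, Submodule.subset_span ⟨rotK j, rfl⟩⟩
  have hdep : ¬ LinearIndependent ℂ w := fun hw => by
    have := hw.finite
    exact not_finite ℕ
  obtain ⟨s, g, hs, i, his, hgi⟩ := not_linearIndependent_iff.1 hdep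
  let q : Polynomial ℂ := ∑ j ∈ s, Polynomial.monomial j (g j)
  have hq : q ≠ 0 := by
    intro h0
    have h1 : q.coeff i = g i := by
      simp [q, Polynomial.finsetSum_coeff, Polynomial.coeff_monomial, his]
    rw [h0, Polynomial.coeff_zero] at h1
    exact hgi h1.symm
  have hroot : ∀ m : KType k, v m ≠ 0 → q.IsRoot (Complex.exp ((m : ℤ) * ((1 : ℝ) * I))) := by
    intro m hm
    have h1 : ((∑ j ∈ s, g j • w j : F) : H k) m = 0 := by rw [hs]; rfl
    have h2 : ((∑ j ∈ s, g j • w j : F) : H k) m =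
        q.eval (Complex.exp ((m : ℤ) * ((1 : ℝ) * I))) * v m := by
      rw [Submodule.coe_sum, lp.coeFn_sum, Finset.sum_apply, Polynomial.eval_finsetSum,
        Finset.sum_mul]
      refine Finset.sum_congr rfl fun j _ => ?_
      rw [Polynomial.eval_monomial, ← Complex.exp_nat_mul]
      change g j * (π.toHom (rot j) v m) = _
      rw [h.toHom_rot_apply hk, mul_assoc]
      congr 3
      push_cast
      ring
    rw [h2] at h1
    exact (mul_eq_zero.1 h1).resolve_right hm
  have hfin : {m : KType k | v m ≠ 0}.Finite := by
    refine Set.Finite.subset (Set.Finite.preimage (f := fun m : KType k =>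
      Complex.exp ((m : ℤ) * ((1 : ℝ) * I))) ?_ (Polynomial.finite_setOfPred_isRoot hq))
      (fun m hm => hroot m hm)
    exact fun m _ n _ hmn => Subtype.ext (exp_int_mul_I_injective hmn)
  have h3 : v = ∑ m ∈ hfin.toFinset, v m • basisVec k m := by
    refine (hasSum_smul_basisVec k v).unique (hasSum_sum_of_ne_finset_zero fun m hm => ?_)
    have : v m = 0 := by simpa using hm
    rw [this, zero_smul]
  rw [h3]
  exact Submodule.sum_mem _ fun m _ =>
    Submodule.smul_mem _ _ (Submodule.subset_span (Set.mem_range_self m))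

end SL2R

namespace SL2R

/-! ### Size of the matrix coefficients -/

/-- Cauchy's estimates for the coefficients of a power series on the circle of radius `1 / 2`. -/
theorem norm_coeff_le {a : ℕ → ℂ} {f : ℂ → ℂ} {M : ℝ}
    (ha : ∀ w : ℂ, ‖w‖ < 1 → HasSum (fun j => a j * w ^ j) (f w))
    (hM : ∀ w : ℂ, ‖w‖ = 1 / 2 → ‖f w‖ ≤ M) (j : ℕ) : ‖a j‖ ≤ M * 2 ^ j := by
  have hf : HasFPowerSeriesOnBall f (FormalMultilinearSeries.ofScalars ℂ a) 0 1 := by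
    refine ⟨?_, one_pos, fun {y} hy => ?_⟩
    · refine ENNReal.le_of_forall_nnreal_lt fun r hr => ?_
      have hr1 : r < 1 := by exact_mod_cast hr
      refine FormalMultilinearSeries.le_radius_of_summable_norm _ ?_
      have h := (ha (r : ℂ) (by simpa using hr1)).summable.norm
      refine h.congr fun j => ?_
      simp
    · have hy1 : ‖y‖ < 1 := by
        rw [Metric.mem_eball, edist_zero_right, enorm_eq_nnnorm] at hy
        exact_mod_cast hy
      have h := ha y hy1
      simp only [FormalMultilinearSeries.ofScalars_apply_eq, smul_eq_mul, zero_add]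
      exact h
  have hd : DifferentiableOn ℂ f (Metric.closedBall 0 ((1 / 2 : NNReal) : ℝ)) := by
    refine hf.differentiableOn.mono fun z hz => ?_
    have hz' : ‖z‖ ≤ 1 / 2 := by simpa using hz
    rw [Metric.mem_eball, edist_zero_right, enorm_eq_nnnorm]
    have : ‖z‖₊ < 1 := by
      rw [← NNReal.coe_lt_coe, coe_nnnorm]
      push_cast
      linarith
    exact_mod_cast this
  -- Uniqueness of power series identifies the given coefficients with the Cauchy integrals.
  have hc := (hd.hasFPowerSeriesOnBall (by norm_num)).hasFPowerSeriesAt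
  have he := hf.hasFPowerSeriesAt.eq_formalMultilinearSeries hc
  have h1 : ‖a j‖ = ‖cauchyPowerSeries f 0 ((1 / 2 : NNReal) : ℝ) j‖ := by
    rw [← he, FormalMultilinearSeries.ofScalars_norm]
  rw [h1]
  refine (norm_cauchyPowerSeries_le _ _ _ _).trans ?_
  have h2 : ‖∫ θ : ℝ in (0 : ℝ)..2 * Real.pi, ‖f (circleMap 0 ((1 / 2 : NNReal) : ℝ) θ)‖‖ ≤
      M * |2 * Real.pi - 0| := by
    refine intervalIntegral.norm_integral_le_of_norm_le_const fun θ _ => ?_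
    rw [norm_norm]
    refine hM _ ?_
    simp [circleMap_zero]
  have h3 := (le_abs_self _).trans h2
  rw [sub_zero, abs_of_pos Real.two_pi_pos] at h3
  have h4 : |((1 / 2 : NNReal) : ℝ)|⁻¹ ^ j = 2 ^ j := by
    norm_num
  rw [h4]
  gcongr
  rw [inv_mul_le_iff₀ Real.two_pi_pos]
  exact h3.trans_eq (mul_comm _ _)

/-- Pairing v with the coherent vectors gives the generating function of √(binom k j) ⟨v, e_j⟩; the
weights are at least 1 and can be dropped from the Cauchy bound. -/
theorem norm_inner_basisVec_le {k : ℤ} (hk : k ≠ 0) {v : H k} {M : ℝ}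
    (h : ∀ (w : ℂ) (hw : ‖w‖ < 1), ‖w‖ = 1 / 2 → ‖inner ℂ v (coh k hk (fnlOf k hk w hw))‖ ≤ M)
    (j : ℕ) : ‖inner ℂ v (basisVec k (typeEquiv k hk j))‖ ≤ M * 2 ^ j := by
  have ha : ∀ w : ℂ, ‖w‖ < 1 → HasSum (fun j => ((Real.sqrt (binom k j) : ℂ) *
      inner ℂ v (basisVec k (typeEquiv k hk j))) * w ^ j)
      (if hw : ‖w‖ < 1 then inner ℂ v (coh k hk (fnlOf k hk w hw)) else 0) := by
    intro w hw
    have h1 := (hasSum_coh_fnlOf k hk w hw).mapL (innerSL ℂ v)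
    rw [dif_pos hw]
    simp only [innerSL_apply_apply, inner_smul_right] at h1
    convert! h1 using 1
    funext j
    ring
  refine le_trans ?_ (norm_coeff_le ha (M := M) (fun w hw => ?_) j)
  · rw [norm_mul]
    refine le_mul_of_one_le_left (norm_nonneg _) ?_
    rw [Complex.norm_real, Real.norm_of_nonneg (Real.sqrt_nonneg _), Real.one_le_sqrt, binom]
    exact_mod_cast Nat.choose_pos (Nat.le_add_left _ _)
  · have hw1 : ‖w‖ < 1 := by rw [hw]; norm_num
    rw [dif_pos hw1]
    exact h w hw1 hw

/-! ### Hilbert–Schmidt norm and lower bounds for the Hermitian form -/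

/-- The squared Hilbert--Schmidt norm. -/
def normSqHS (x : G) : ℝ := x 0 0 ^ 2 + x 0 1 ^ 2 + x 1 0 ^ 2 + x 1 1 ^ 2

theorem normSqHS_inv (x : G) : normSqHS x⁻¹ = normSqHS x := by
  obtain ⟨h1, h2, h3, h4⟩ := inv_apply x
  rw [normSqHS, normSqHS, h1, h2, h3, h4]
  ring

theorem two_le_normSqHS (x : G) : 2 ≤ normSqHS x := by
  have := det_entries x
  rw [normSqHS]
  nlinarith [sq_nonneg (x 0 0 - x 1 1), sq_nonneg (x 0 1 + x 1 0)]

/-- For x with rows (a, b) and (c, d), P equals ((a + d) + iε(c - b)) / 2 with ε = sign k, and (a +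
d)² + (c - b)² = ‖x‖² + 2 because the determinant is 1. -/
theorem sq_norm_fP_act (k : ℤ) (hk : k ≠ 0) (x : G) :
    ‖fP k (act x (preFnl k 0))‖ ^ 2 = (normSqHS x + 2) / 4 := by
  obtain ⟨h1, h2, h3, h4⟩ := inv_apply x
  have h5 : fP k (act x (preFnl k 0)) =
      (((x 0 0 + x 1 1) / 2 : ℝ) : ℂ) + (((k.sign : ℝ) * (x 1 0 - x 0 1) / 2 : ℝ) : ℂ) * I := by
    simp only [fP, act, preFnl, h1, h2, h3, h4]
    push_cast
    linear_combination (-(x 0 0 : ℂ) / 2 * I ^ 2) * sign_sq k hk - (x 0 0 : ℂ) / 2 * I_sq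
  have h6 : (k.sign : ℝ) * k.sign = 1 := by exact_mod_cast sign_sq k hk
  rw [h5, ← Complex.normSq_eq_norm_sq, Complex.normSq_add_mul_I, normSqHS]
  linear_combination ((x 1 0 - x 0 1) ^ 2 / 4) * h6 + det_entries x / 2

theorem conj_herm (k : ℤ) (u v : ℂ × ℂ) : conj (herm k u v) = herm k v u := by
  simp only [herm, map_sub, map_mul, Complex.conj_conj]
  ring

/-- The pairing is P + conj(w) Q with |Q| < |P|, so |w| = 1/2 costs at most half of |P|. -/
theorem norm_herm_preFnl_ge (k : ℤ) (hk : k ≠ 0) {w : ℂ} (hw : ‖w‖ = 1 / 2) (v : Fnl k) :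
    ‖fP k v.1‖ / 2 ≤ ‖herm k (preFnl k w) v.1‖ := by
  have h : herm k (preFnl k w) v.1 = fP k v.1 - -(conj w * fQ k v.1) := by
    rw [herm, fP_preFnl k hk, fQ_preFnl k hk]
    simp
  have h1 := norm_sub_norm_le (fP k v.1) (-(conj w * fQ k v.1))
  rw [← h, norm_neg, norm_mul, RCLike.norm_conj, hw] at h1
  linarith [v.2]

theorem herm_act_left (k : ℤ) (x : G) (u v : ℂ × ℂ) :
    herm k (act x⁻¹ u) v = herm k u (act x v) := by
  rw [← herm_act k x, ← act_mul, mul_inv_cancel, act_one]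

theorem fP_eq_herm (k : ℤ) (hk : k ≠ 0) (v : ℂ × ℂ) : fP k v = herm k (preFnl k 0) v := by
  rw [herm, fP_preFnl k hk, fQ_preFnl k hk]
  simp

/-- The half-bound is used twice: once to replace z by 0, then, after moving x to the other side by
invariance, once to replace w by 0. What remains is the explicit |P| of x⁻¹ at the centre. -/
theorem sqrt_normSqHS_le_norm_herm (k : ℤ) (hk : k ≠ 0) (x : G) {z w : ℂ} (hz : ‖z‖ = 1 / 2)
    (hw : ‖w‖ = 1 / 2) :
    Real.sqrt ((normSqHS x + 2) / 4) / 4 ≤ ‖herm k (preFnl k z) (act x (preFnl k w))‖ := by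
  have hw1 : ‖w‖ < 1 := by rw [hw]; norm_num
  have h1 := norm_herm_preFnl_ge k hk hz (x • fnlOf k hk w hw1)
  have h2 := norm_herm_preFnl_ge k hk hw (x⁻¹ • fnlOf k hk 0 (by simp))
  simp only [coe_smul, fnlOf] at h1 h2
  rw [fP_eq_herm k hk, ← herm_act_left, ← conj_herm, RCLike.norm_conj] at h1
  have h3 : Real.sqrt ((normSqHS x + 2) / 4) = ‖fP k (act x⁻¹ (preFnl k 0))‖ := by
    rw [← normSqHS_inv, ← sq_norm_fP_act k hk, Real.sqrt_sq (norm_nonneg _)]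
  rw [h3]
  linarith

/-! ### Decay of the K-finite matrix coefficients -/

variable {k : ℤ} {π : UnitaryRep G (H k)}

/-- The decay rate `‖x‖ ^ (-(|k| + 1))` of the matrix coefficients, normalised at the identity. -/
noncomputable def decay (k : ℤ) (x : G) : ℝ := (Real.sqrt ((normSqHS x + 2) / 4) ^ (k.natAbs + 1))⁻¹

theorem sqrt_normSqHS_pos (x : G) : 0 < Real.sqrt ((normSqHS x + 2) / 4) :=
  Real.sqrt_pos.2 (by linarith [two_le_normSqHS x])

theorem decay_pos (k : ℤ) (x : G) : 0 < decay k x :=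
  inv_pos.2 (pow_pos (sqrt_normSqHS_pos x) _)

/-- Cauchy's estimate is applied in each variable of the coherent kernel; 4^(|k| + 1) is the quarter
lost in `sqrt_normSqHS_le_norm_herm`, raised to the power of the kernel. -/
theorem IsDiscreteSeries.norm_matrixCoeff_basisVec_le (h : IsDiscreteSeries k π) (hk : k ≠ 0)
    (i j : ℕ) (x : G) :
    ‖π.matrixCoeff (basisVec k (typeEquiv k hk j)) (basisVec k (typeEquiv k hk i)) x‖ ≤
      4 ^ (k.natAbs + 1) * 2 ^ i * 2 ^ j * decay k x := by
  have h1 : ∀ (z : ℂ) (hz : ‖z‖ < 1), ‖z‖ = 1 / 2 → ∀ (w : ℂ) (hw : ‖w‖ < 1), ‖w‖ = 1 / 2 →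
      ‖inner ℂ (π.toHom x⁻¹ (coh k hk (fnlOf k hk z hz))) (coh k hk (fnlOf k hk w hw))‖ ≤
      4 ^ (k.natAbs + 1) * decay k x := by
    intro z hz hz' w hw hw'
    rw [π.inner_toHom_inv, h.toHom_coh hk, inner_coh, coe_smul, norm_inv, norm_pow, decay]
    have h2 := sqrt_normSqHS_le_norm_herm k hk x hz' hw'
    have h3 : 4 ^ (k.natAbs + 1) * (Real.sqrt ((normSqHS x + 2) / 4) ^ (k.natAbs + 1))⁻¹ =
        ((Real.sqrt ((normSqHS x + 2) / 4) / 4) ^ (k.natAbs + 1))⁻¹ := by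
      rw [div_pow _ (4 : ℝ), inv_div]
      exact (div_eq_mul_inv _ _).symm
    rw [h3]
    have h4 := sqrt_normSqHS_pos x
    exact inv_anti₀ (by positivity) (pow_le_pow_left₀ (by positivity) h2 _)
  -- The coefficient in w is extracted with z fixed; the same lemma is then applied in z.
  have h2 : ∀ (z : ℂ) (hz : ‖z‖ < 1), ‖z‖ = 1 / 2 →
      ‖inner ℂ (π.toHom x (basisVec k (typeEquiv k hk j))) (coh k hk (fnlOf k hk z hz))‖ ≤
      4 ^ (k.natAbs + 1) * decay k x * 2 ^ j := by
    intro z hz hz'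
    have h3 := norm_inner_basisVec_le hk (h1 z hz hz') j
    rwa [π.inner_toHom_inv, norm_inner_symm] at h3
  have h3 := norm_inner_basisVec_le hk h2 i
  rw [norm_inner_symm] at h3
  refine h3.trans (le_of_eq ?_)
  ring

/-- The extremal vector is the coherent vector at the centre. Equality here, not just a bound, is
what yields necessity of the condition on p. -/
theorem IsDiscreteSeries.norm_matrixCoeff_lowest (h : IsDiscreteSeries k π) (hk : k ≠ 0) (x : G) :
    ‖π.matrixCoeff (basisVec k (typeEquiv k hk 0)) (basisVec k (typeEquiv k hk 0)) x‖ =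
      decay k x := by
  rw [UnitaryRep.matrixCoeff, basisVec_zero_eq_coh, h.toHom_coh hk, inner_coh, coe_smul, norm_inv,
    norm_pow, decay, ← sq_norm_fP_act k hk, Real.sqrt_sq (norm_nonneg _), fP_eq_herm k hk]
  rfl

theorem IsDiscreteSeries.exists_norm_matrixCoeff_le (h : IsDiscreteSeries k π) (hk : k ≠ 0)
    {u v : H k} (hu : u ∈ Submodule.span ℂ (Set.range (basisVec k)))
    (hv : v ∈ Submodule.span ℂ (Set.range (basisVec k))) :
    ∃ C : ℝ, 0 < C ∧ ∀ x, ‖π.matrixCoeff u v x‖ ≤ C * decay k x := by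
  simp only [UnitaryRep.matrixCoeff]
  induction hu using Submodule.span_induction with
  | mem u hu =>
    obtain ⟨n, rfl⟩ := hu
    obtain ⟨j, rfl⟩ := (typeEquiv k hk).surjective n
    induction hv using Submodule.span_induction with
    | mem v hv =>
      obtain ⟨m, rfl⟩ := hv
      obtain ⟨i, rfl⟩ := (typeEquiv k hk).surjective m
      exact ⟨_, by positivity, h.norm_matrixCoeff_basisVec_le hk i j⟩
    | zero => exact ⟨1, one_pos, fun x => by simpa using (decay_pos k x).le⟩
    | add a b _ _ ha hb =>
      obtain ⟨C, hC, hC'⟩ := ha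
      obtain ⟨D, hD, hD'⟩ := hb
      refine ⟨C + D, add_pos hC hD, fun x => ?_⟩
      rw [inner_add_left, add_mul]
      exact (norm_add_le _ _).trans (add_le_add (hC' x) (hD' x))
    | smul c a _ ha =>
      obtain ⟨C, hC, hC'⟩ := ha
      -- The added 1 keeps the constant positive when c = 0.
      refine ⟨(‖c‖ + 1) * C, by positivity, fun x => ?_⟩
      rw [inner_smul_left, norm_mul, RCLike.norm_conj, mul_assoc]
      exact mul_le_mul (by linarith) (hC' x) (norm_nonneg _) (by positivity)
  | zero => exact ⟨1, one_pos, fun x => by simpa using (decay_pos k x).le⟩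
  | add a b _ _ ha hb =>
    obtain ⟨C, hC, hC'⟩ := ha
    obtain ⟨D, hD, hD'⟩ := hb
    refine ⟨C + D, add_pos hC hD, fun x => ?_⟩
    rw [map_add, inner_add_right, add_mul]
    exact (norm_add_le _ _).trans (add_le_add (hC' x) (hD' x))
  | smul c a _ ha =>
    obtain ⟨C, hC, hC'⟩ := ha
    refine ⟨(‖c‖ + 1) * C, by positivity, fun x => ?_⟩
    rw [map_smul, inner_smul_right, norm_mul, mul_assoc]
    exact mul_le_mul (by linarith) (hC' x) (norm_nonneg _) (by positivity)

end SL2R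

namespace SL2R

/-! ### Volume growth -/

/-- The squared length of the second row of `x`, the inverse height of `x • i` in the upper
half-plane. -/
def rowSq (x : G) : ℝ := x 1 0 ^ 2 + x 1 1 ^ 2

/-- The inner product of the two rows of `x`. -/
def rowInner (x : G) : ℝ := x 0 0 * x 1 0 + x 0 1 * x 1 1

theorem rowSq_pos (x : G) : 0 < rowSq x := by
  have h := det_entries x
  rw [rowSq]
  by_contra! h1
  have h2 : x 1 0 = 0 := by nlinarith [sq_nonneg (x 1 0), sq_nonneg (x 1 1)]
  have h3 : x 1 1 = 0 := by nlinarith [sq_nonneg (x 1 0), sq_nonneg (x 1 1)]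
  rw [h2, h3] at h
  norm_num at h

/-- Lagrange's identity for the two rows, with determinant 1. It makes the norm a function of
`rowSq` and `rowInner`. -/
theorem normSqHS_mul_rowSq (x : G) :
    (normSqHS x - rowSq x) * rowSq x = rowInner x ^ 2 + 1 := by
  rw [normSqHS, rowSq, rowInner]
  linear_combination (x 0 0 * x 1 1 - x 0 1 * x 1 0 + 1) * det_entries x

/-- An upper triangular matrix. -/
noncomputable def upper (α : ℝ) (hα : α ≠ 0) (l : ℝ) : G :=
  ⟨!![α⁻¹, -(α * l); 0, α], by rw [Matrix.det_fin_two_of]; field_simp; ring⟩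

theorem upper_apply {α : ℝ} (hα : α ≠ 0) (l : ℝ) :
    upper α hα l 0 0 = α⁻¹ ∧ upper α hα l 0 1 = -(α * l) ∧ upper α hα l 1 0 = 0 ∧
      upper α hα l 1 1 = α :=
  ⟨rfl, rfl, rfl, rfl⟩

theorem rowSq_upper_mul {α : ℝ} (hα : α ≠ 0) (l : ℝ) (x : G) :
    rowSq (upper α hα l * x) = α ^ 2 * rowSq x := by
  obtain ⟨-, -, h3, h4⟩ := upper_apply hα l
  simp only [rowSq, mul_apply_two, h3, h4]
  ring

/-- The shift is l times the new `rowSq`: α normalises `rowSq`, then an integer l reduces `rowInner`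
modulo it. -/
theorem rowInner_upper_mul {α : ℝ} (hα : α ≠ 0) (l : ℝ) (x : G) :
    rowInner (upper α hα l * x) = rowInner x - l * (α ^ 2 * rowSq x) := by
  obtain ⟨h1, h2, h3, h4⟩ := upper_apply hα l
  simp only [rowSq, rowInner, mul_apply_two, h1, h2, h3, h4]
  field_simp
  ring

theorem continuous_entry (i j : Fin 2) : Continuous fun x : G => (x i j : ℝ) :=
  continuous_subtype_val.matrix_elem i j

theorem continuous_rowSq : Continuous rowSq := by
  have := continuous_entry
  unfold rowSq
  exact ((this 1 0).pow 2).add ((this 1 1).pow 2)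

theorem continuous_rowInner : Continuous rowInner := by
  have := continuous_entry
  unfold rowInner
  exact ((this 0 0).mul (this 1 0)).add ((this 0 1).mul (this 1 1))

/-- Reduction theory: α = 2^(N-i) brings `rowSq` into [1, 4], and l is the floor of `rowInner` over
`rowSq`. About 2^i values of l occur at scale i, hence about 4^N translates in all. -/
theorem exists_upper_mul_mem (x : G) (N : ℕ) (hx : normSqHS x ≤ 4 ^ N) :
    ∃ i ∈ Finset.range (2 * N + 1), ∃ l ∈ Finset.Icc (-(3 * 2 ^ i) : ℤ) (3 * 2 ^ i),
      normSqHS (upper (2 ^ N / 2 ^ i) (by positivity) l * x) ≤ 9 := by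
  have hD := rowSq_pos x
  have hE := normSqHS_mul_rowSq x
  have hxD : 0 ≤ normSqHS x - rowSq x := by
    rw [normSqHS, rowSq]
    nlinarith [sq_nonneg (x 0 0), sq_nonneg (x 0 1)]
  have h44 : (4 : ℝ) ^ N * 4 ^ N = 4 ^ (2 * N) := by rw [two_mul, pow_add]
  have h1 : rowInner x ^ 2 + 1 ≤ 4 ^ N * rowSq x := by
    rw [← hE]
    exact mul_le_mul_of_nonneg_right (by linarith) hD.le
  -- The quantity lies between 1 and 4^(2N), and i is its base-4 logarithm rounded down.
  obtain ⟨i, hi1, hi2⟩ := exists_nat_pow_near (x := 4 ^ N * rowSq x) (y := (4 : ℝ))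
    (by nlinarith [sq_nonneg (rowInner x)]) (by norm_num)
  have hi : i ≤ 2 * N := by
    have : (4 : ℝ) ^ i ≤ 4 ^ (2 * N) := by
      refine hi1.trans ?_
      rw [← h44]
      gcongr
      linarith
    exact (pow_le_pow_iff_right₀ (by norm_num)).1 this
  set α : ℝ := 2 ^ N / 2 ^ i with hα
  have hα0 : α ≠ 0 := by positivity
  have h2i : (0 : ℝ) < 2 ^ i := by positivity
  have h4i : (4 : ℝ) ^ i = 2 ^ i * 2 ^ i := by rw [← mul_pow]; norm_num
  have h4N : (4 : ℝ) ^ N = 2 ^ N * 2 ^ N := by rw [← mul_pow]; norm_num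
  have hD' : α ^ 2 * rowSq x = 4 ^ N * rowSq x / 4 ^ i := by
    rw [hα, h4i, h4N]
    field_simp
  have hD1 : 1 ≤ α ^ 2 * rowSq x := by
    rw [hD', le_div_iff₀ (by positivity), one_mul]
    exact hi1
  have hD4 : α ^ 2 * rowSq x ≤ 4 := by
    rw [hD', div_le_iff₀ (by positivity)]
    rw [pow_succ] at hi2
    linarith
  have hEi : |rowInner x| ≤ 2 * 2 ^ i := by
    refine abs_le_of_sq_le_sq ?_ (by positivity)
    rw [pow_succ, h4i] at hi2
    nlinarith
  have hq : |rowInner x / (α ^ 2 * rowSq x)| ≤ 2 * 2 ^ i := by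
    rw [abs_div, abs_of_pos (by linarith : 0 < α ^ 2 * rowSq x)]
    exact (div_le_self (abs_nonneg _) hD1).trans hEi
  have hi1' : (1 : ℝ) ≤ 2 ^ i := one_le_pow₀ (by norm_num)
  obtain ⟨hq1, hq2⟩ := abs_le.1 hq
  set l : ℤ := ⌊rowInner x / (α ^ 2 * rowSq x)⌋ with hl
  have hl1 := Int.floor_le (rowInner x / (α ^ 2 * rowSq x))
  have hl2 := Int.lt_floor_add_one (rowInner x / (α ^ 2 * rowSq x))
  rw [← hl] at hl1 hl2
  refine ⟨i, Finset.mem_range.2 (by omega), l, Finset.mem_Icc.2 ⟨?_, ?_⟩, ?_⟩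
  · have : (-(3 * 2 ^ i) : ℝ) ≤ l := by linarith
    exact_mod_cast this
  · have : (l : ℝ) ≤ 3 * 2 ^ i := by linarith
    exact_mod_cast this
  -- With D' in [1, 4] and E' in [0, D'], the squared norm D' + (E'² + 1) / D' is at most 2D' + 1/D'
  -- ≤ 9.
  · rw [le_div_iff₀ (by linarith)] at hl1
    rw [div_lt_iff₀ (by linarith)] at hl2
    have h3 := normSqHS_mul_rowSq (upper α hα0 l * x)
    rw [rowSq_upper_mul, rowInner_upper_mul] at h3
    set D' := α ^ 2 * rowSq x
    set E' := rowInner x - l * D'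
    have hE0 : 0 ≤ E' := by simp only [E']; linarith
    have hE1 : E' ≤ D' := by simp only [E']; linarith
    by_contra! h9
    nlinarith

/-- Undoing the translation gives D = `rowSq x` between 4^N and 4 · 4^N and `rowInner x` between 0
and D; Lagrange's identity then bounds the squared norm by 2D + 1/D ≤ 9 · 4^N. -/
theorem normSqHS_le_of_upper_mul_mem_box {x : G} {N l : ℕ} (hl : l < 4 ^ N)
    (h1 : rowSq (upper (2 ^ N)⁻¹ (by positivity) l * x) < 4)
    (h1' : 1 < rowSq (upper (2 ^ N)⁻¹ (by positivity) l * x))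
    (h2 : 0 < rowInner (upper (2 ^ N)⁻¹ (by positivity) l * x))
    (h3 : rowInner (upper (2 ^ N)⁻¹ (by positivity) l * x) <
      rowSq (upper (2 ^ N)⁻¹ (by positivity) l * x)) :
    normSqHS x ≤ 9 * 4 ^ N := by
  rw [rowSq_upper_mul] at h1 h1' h3
  rw [rowInner_upper_mul] at h2 h3
  have hE := normSqHS_mul_rowSq x
  have h4N : (4 : ℝ) ^ N = 2 ^ N * 2 ^ N := by rw [← mul_pow]; norm_num
  have h1N : (1 : ℝ) ≤ 4 ^ N := one_le_pow₀ (by norm_num)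
  set D' : ℝ := ((2 ^ N)⁻¹ : ℝ) ^ 2 * rowSq x with hD'
  have hD : rowSq x = 4 ^ N * D' := by
    rw [hD', h4N]
    field_simp
  have hl' : (l : ℝ) + 1 ≤ 4 ^ N := by exact_mod_cast hl
  have hl0 : (0 : ℝ) ≤ l := Nat.cast_nonneg l
  have hE1 : rowInner x ≤ rowSq x := by rw [hD]; nlinarith
  have hE0 : 0 ≤ rowInner x := by nlinarith
  have hD1 : 1 ≤ rowSq x := by rw [hD]; nlinarith
  have hD4 : rowSq x ≤ 4 * 4 ^ N := by rw [hD]; nlinarith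
  by_contra! h9
  nlinarith

/-- A fundamental box for the translates by upper triangular matrices. -/
def box : Set G := {x | 0 < rowInner x ∧ rowInner x < rowSq x ∧ 1 < rowSq x ∧ rowSq x < 4}

theorem isOpen_box : IsOpen box := by
  have h1 := continuous_rowSq
  have h2 := continuous_rowInner
  exact (isOpen_lt continuous_const h2).inter ((isOpen_lt h2 h1).inter
    ((isOpen_lt continuous_const h1).inter (isOpen_lt h1 continuous_const)))

/-! ### Haar measure of Hilbert–Schmidt balls -/

variable [MeasurableSpace G] (μ : Measure G) [μ.IsHaarMeasure]

theorem measure_normSqHS_le_lt_top : μ {x | normSqHS x ≤ 9} < ∞ := by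
  have hc : IsCompact (Set.univ.pi fun _ => Set.univ.pi fun _ => Set.Icc (-3 : ℝ) 3 :
      Set (Matrix (Fin 2) (Fin 2) ℝ)) :=
    isCompact_univ_pi fun _ => isCompact_univ_pi fun _ => isCompact_Icc
  have hK : IsCompact ((fun x : G => (x : Matrix (Fin 2) (Fin 2) ℝ)) ⁻¹' _) :=
    Matrix.SpecialLinearGroup.isClosedEmbedding_val.isCompact_preimage hc
  refine (measure_mono ?_).trans_lt hK.measure_lt_top
  intro x hx i _ j _
  have h : x i j ^ 2 ≤ normSqHS x := by
    have := sq_nonneg (x 0 0)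
    have := sq_nonneg (x 0 1)
    have := sq_nonneg (x 1 0)
    have := sq_nonneg (x 1 1)
    rw [normSqHS]
    fin_cases i <;> fin_cases j <;> simp only [Fin.zero_eta, Fin.mk_one] <;> linarith
  have h9 : x i j ^ 2 ≤ 3 ^ 2 := by
    have : normSqHS x ≤ 9 := hx
    linarith
  exact abs_le.1 (abs_le_of_sq_le_sq h9 (by norm_num))

/-- By left invariance only the number of translates counts: at most 7 · 2^i at scale i, and the
geometric sum over i ≤ 2N is at most 2 · 4^N. -/
theorem measure_normSqHS_le [BorelSpace G] (N : ℕ) :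
    μ {x | normSqHS x ≤ 4 ^ N} ≤ 14 * 4 ^ N * μ {x | normSqHS x ≤ 9} := by
  have hsub : {x | normSqHS x ≤ 4 ^ N} ⊆ ⋃ i ∈ Finset.range (2 * N + 1),
      ⋃ l ∈ Finset.Icc (-(3 * 2 ^ i) : ℤ) (3 * 2 ^ i),
      (fun x => upper (2 ^ N / 2 ^ i) (by positivity) l * x) ⁻¹' {x | normSqHS x ≤ 9} := by
    intro x hx
    simp only [Set.mem_iUnion]
    obtain ⟨i, hi, l, hl, h⟩ := exists_upper_mul_mem x N hx
    exact ⟨i, hi, l, hl, h⟩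
  refine (measure_mono hsub).trans ?_
  calc _ ≤ ∑ i ∈ Finset.range (2 * N + 1), ∑ l ∈ Finset.Icc (-(3 * 2 ^ i) : ℤ) (3 * 2 ^ i),
        μ {x | normSqHS x ≤ 9} := by
        refine (measure_biUnion_finset_le _ _).trans (Finset.sum_le_sum fun i _ => ?_)
        refine (measure_biUnion_finset_le _ _).trans (Finset.sum_le_sum fun l _ => ?_)
        rw [measure_preimage_mul]
    _ ≤ ∑ i ∈ Finset.range (2 * N + 1), 7 * 2 ^ i * μ {x | normSqHS x ≤ 9} := by
        refine Finset.sum_le_sum fun i _ => ?_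
        rw [Finset.sum_const, Int.card_Icc, nsmul_eq_mul]
        gcongr
        have h1 : (1 : ℕ) ≤ 2 ^ i := Nat.one_le_two_pow
        have h2 : (3 * 2 ^ i + 1 - -(3 * 2 ^ i) : ℤ).toNat ≤ 7 * 2 ^ i := by
          rw [Int.toNat_le]
          push_cast
          have : (1 : ℤ) ≤ 2 ^ i := by exact_mod_cast h1
          linarith
        exact_mod_cast h2
    _ ≤ 14 * 4 ^ N * μ {x | normSqHS x ≤ 9} := by
        rw [← Finset.sum_mul, ← Finset.mul_sum]
        have h1 : ∑ i ∈ Finset.range (2 * N + 1), 2 ^ i ≤ 2 * 4 ^ N := by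
          have h2 := Nat.geomSum_eq (m := 2) le_rfl (2 * N + 1)
          rw [h2, pow_succ, pow_mul]
          norm_num
          omega
        have h2 : 7 * ∑ i ∈ Finset.range (2 * N + 1), 2 ^ i ≤ 14 * 4 ^ N := by omega
        have h3 : (7 * ∑ i ∈ Finset.range (2 * N + 1), 2 ^ i : ℝ≥0∞) ≤ 14 * 4 ^ N := by
          exact_mod_cast h2
        exact mul_le_mul_left h3 _

theorem measure_box_pos : 0 < μ box := by
  refine isOpen_box.measure_pos μ
    ⟨⟨!![2 / 3, 3 / 4; 0, 3 / 2], by norm_num [Matrix.det_fin_two_of]⟩, ?_⟩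
  refine ⟨?_, ?_, ?_, ?_⟩ <;> simp only [rowSq, rowInner] <;>
    norm_num [Matrix.SpecialLinearGroup.coe_mk]

/-- Packing: 4^N disjoint translates of the open box fit into the ball. -/
theorem le_measure_normSqHS_le [BorelSpace G] (N : ℕ) : 4 ^ N * μ box ≤ μ {x | normSqHS x ≤ 9 * 4 ^ N} := by
  have hsub : (⋃ l ∈ Finset.range (4 ^ N),
      (fun x => upper (2 ^ N)⁻¹ (by positivity) (l : ℕ) * x) ⁻¹' box) ⊆
      {x | normSqHS x ≤ 9 * 4 ^ N} := by
    intro x hx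
    simp only [Set.mem_iUnion] at hx
    obtain ⟨l, hl, h1, h2, h3, h4⟩ := hx
    exact normSqHS_le_of_upper_mul_mem_box (Finset.mem_range.1 hl) h4 h3 h1 h2
  refine le_trans ?_ (measure_mono hsub)
  rw [measure_biUnion_finset]
  · simp [measure_preimage_mul]
  -- Both translates have the same `rowSq`, and membership places `rowInner x` strictly between l
  -- and l + 1 times it; the symmetric use forces l = m.
  · have hlt : ∀ (l m : ℕ) (x : G), upper (2 ^ N)⁻¹ (by positivity) (l : ℕ) * x ∈ box →
        upper (2 ^ N)⁻¹ (by positivity) (m : ℕ) * x ∈ box → l < m + 1 := by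
      rintro l m x ⟨h1, h2, h3, h4⟩ ⟨h1', h2', h3', h4'⟩
      rw [rowInner_upper_mul] at h1 h2 h1' h2'
      rw [rowSq_upper_mul] at h2 h2' h3
      have h5 : (l : ℝ) < (m + 1 : ℕ) := by
        push_cast
        by_contra! h6
        nlinarith
      exact_mod_cast h5
    intro l _ m _ hlm
    refine Set.disjoint_left.2 fun x hx hx' => hlm ?_
    have := hlt l m x hx hx'
    have := hlt m l x hx' hx
    omega
  · intro l _
    exact (isOpen_box.preimage (continuous_const_mul _)).measurableSet

end SL2R

namespace SL2R

/-! ### Weak `L^p` membership -/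

variable {k : ℤ} {π : UnitaryRep G (H k)} [MeasurableSpace G] [BorelSpace G]
  {μ : Measure G} [μ.IsHaarMeasure] {p : ℝ}

/-- The bound must not depend on α. For α < C the level set lies in a ball of radius comparable to T
= (C/α)^(1/n), of measure O(T²), and T² ≤ (C/α)^p since C/α ≥ 1 and 2/n ≤ p. -/
theorem measure_lt_decay_le {C α : ℝ} (hα : 0 < α) (hC : 0 < C)
    (hp : 2 ≤ p * (k.natAbs + 1)) :
    ENNReal.ofReal (α ^ p) * μ {x | α < C * decay k x} ≤
      ENNReal.ofReal (C ^ p) * (14 * 4 ^ 2 * μ {x | normSqHS x ≤ 9}) := by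
  set n : ℕ := k.natAbs + 1 with hn
  have hn' : p * (k.natAbs + 1) = p * n := by rw [hn]; push_cast; rfl
  rw [hn'] at hp
  have hR : ∀ x : G, 1 ≤ Real.sqrt ((normSqHS x + 2) / 4) := fun x => by
    rw [Real.one_le_sqrt]
    linarith [two_le_normSqHS x]
  have hdecay : ∀ x : G, α < C * decay k x → Real.sqrt ((normSqHS x + 2) / 4) ^ n < C / α := by
    intro x hx
    have h0 := pow_pos (sqrt_normSqHS_pos x) n
    rw [decay, ← hn, ← div_eq_mul_inv, lt_div_iff₀ h0] at hx
    rw [lt_div_iff₀ hα, mul_comm]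
    exact hx
  -- As `decay` is at most 1, the level set is empty in this case.
  by_cases hαC : C ≤ α
  · have : {x : G | α < C * decay k x} = ∅ := by
      rw [Set.eq_empty_iff_forall_notMem]
      intro x hx
      have h1 := hdecay x hx
      have h2 : C / α ≤ 1 := (div_le_one hα).2 hαC
      exact absurd (one_le_pow₀ (hR x) (n := n)) (by linarith)
    rw [this, measure_empty, mul_zero]
    exact zero_le
  push Not at hαC
  have hq : 1 ≤ C / α := (one_le_div hα).2 hαC.le
  have hn0 : (n : ℝ) ≠ 0 := by positivity
  set T : ℝ := (C / α) ^ (n : ℝ)⁻¹ with hT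
  have hT1 : 1 ≤ T := Real.one_le_rpow hq (by positivity)
  have hTn : T ^ n = C / α := Real.rpow_inv_natCast_pow (by positivity) (by positivity)
  obtain ⟨N, hN1, hN2⟩ := exists_nat_pow_near hT1 (one_lt_two)
  have h4 : ∀ m : ℕ, (4 : ℝ) ^ m = (2 ^ m) ^ 2 := fun m => by
    rw [← pow_mul, mul_comm, pow_mul]; norm_num
  -- From T < 2^(N+1) one gets ‖x‖² + 2 ≤ 4 · 4^(N+1), whence the exponent N + 2.
  have hsub : {x : G | α < C * decay k x} ⊆ {x | normSqHS x ≤ 4 ^ (N + 2)} := by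
    intro x hx
    have h1 : Real.sqrt ((normSqHS x + 2) / 4) < T := by
      refine lt_of_pow_lt_pow_left₀ n (by positivity) ?_
      rw [hTn]
      exact hdecay x hx
    have h2 := Real.sq_sqrt (by linarith [two_le_normSqHS x] : 0 ≤ (normSqHS x + 2) / 4)
    have h3 : Real.sqrt ((normSqHS x + 2) / 4) ^ 2 ≤ (2 ^ (N + 1)) ^ 2 :=
      pow_le_pow_left₀ (Real.sqrt_nonneg _) (h1.trans hN2).le 2
    rw [h2, ← h4] at h3
    change normSqHS x ≤ 4 ^ (N + 2)
    rw [pow_succ] at h3 ⊢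
    rw [pow_succ]
    linarith
  have hpow : α ^ p * 4 ^ N ≤ C ^ p := by
    calc α ^ p * 4 ^ N ≤ α ^ p * T ^ 2 := by
          rw [h4]
          gcongr
      _ ≤ α ^ p * (C / α) ^ p := by
          gcongr
          rw [hT, ← Real.rpow_natCast, ← Real.rpow_mul (by positivity)]
          refine Real.rpow_le_rpow_of_exponent_le hq ?_
          rw [inv_mul_le_iff₀ (by positivity)]
          push_cast
          linarith
      _ = C ^ p := by
          rw [← Real.mul_rpow hα.le (by positivity), mul_div_cancel₀ _ hα.ne']
  have h4N : ENNReal.ofReal (4 ^ N) = 4 ^ N := by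
    rw [ENNReal.ofReal_pow (by norm_num)]
    norm_num
  calc ENNReal.ofReal (α ^ p) * μ {x | α < C * decay k x}
      ≤ ENNReal.ofReal (α ^ p) * (14 * 4 ^ (N + 2) * μ {x | normSqHS x ≤ 9}) := by
        gcongr
        exact (measure_mono hsub).trans (measure_normSqHS_le μ (N + 2))
    _ = ENNReal.ofReal (α ^ p * 4 ^ N) * (14 * 4 ^ 2 * μ {x | normSqHS x ≤ 9}) := by
        rw [ENNReal.ofReal_mul (by positivity), h4N]
        ring
    _ ≤ _ := by gcongr

theorem IsDiscreteSeries.memWeakLp (h : IsDiscreteSeries k π) (hk : k ≠ 0)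
    (hp : 2 ≤ p * (k.natAbs + 1)) {u v : H k} (hu : π.IsKFinite K u) (hv : π.IsKFinite K v) :
    MemWeakLp (π.matrixCoeff u v) p μ := by
  obtain ⟨C, hC, hC'⟩ := h.exists_norm_matrixCoeff_le hk (h.mem_span_of_isKFinite hk hu)
    (h.mem_span_of_isKFinite hk hv)
  refine ⟨(continuous_const.inner (π.continuous_orbit u)).measurable, ?_⟩
  refine (iSup_le fun α => ?_ : _ ≤
    ENNReal.ofReal (C ^ p) * (14 * 4 ^ 2 * μ {x | normSqHS x ≤ 9})).trans_lt ?_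
  · refine le_trans ?_ (measure_lt_decay_le α.2 hC hp)
    gcongr with x
    exact hC' x
  · exact ENNReal.mul_lt_top ENNReal.ofReal_lt_top
      (ENNReal.mul_lt_top (by norm_num) (measure_normSqHS_le_lt_top μ))

/-- If p n < 2, the levels α = 2^(-(N+1)n) give values at least a constant times r^N, where r = 2^(2
- pn) > 1, and these are unbounded. -/
theorem two_le_of_iSup_decay_lt_top
    (h : (⨆ α : Set.Ioi (0 : ℝ), ENNReal.ofReal ((α : ℝ) ^ p) *
      μ {x | (α : ℝ) < decay k x}) < ∞) : 2 ≤ p * (k.natAbs + 1) := by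
  by_contra! hp
  set M := ⨆ α : Set.Ioi (0 : ℝ), ENNReal.ofReal ((α : ℝ) ^ p) * μ {x | (α : ℝ) < decay k x}
  set n : ℕ := k.natAbs + 1 with hn
  have hn' : p * (k.natAbs + 1) = p * n := by rw [hn]; push_cast; rfl
  rw [hn'] at hp
  set r : ℝ := 2 ^ (2 - p * n) with hr
  have hr1 : 1 < r := Real.one_lt_rpow one_lt_two (by linarith)
  have key : ∀ N : ℕ, ENNReal.ofReal (r ^ N * 2 ^ (-(p * n))) * μ box ≤ M := by
    intro N
    set α : ℝ := ((2 ^ (N + 1)) ^ n)⁻¹ with hα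
    have hα0 : 0 < α := by positivity
    have hsub : {x : G | normSqHS x ≤ 9 * 4 ^ N} ⊆ {x | α < decay k x} := by
      intro x hx
      have hx' : normSqHS x ≤ 9 * 4 ^ N := hx
      have h4 : (4 : ℝ) ^ N = (2 ^ N) ^ 2 := by rw [← pow_mul, mul_comm, pow_mul]; norm_num
      have h1N : (1 : ℝ) ≤ 4 ^ N := one_le_pow₀ (by norm_num)
      -- Here 9 · 4^N + 2 ≤ 11 · 4^N < 16 · 4^N, which is why the level uses 2^(N+1).
      have h1 : Real.sqrt ((normSqHS x + 2) / 4) < 2 ^ (N + 1) := by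
        rw [Real.sqrt_lt' (by positivity), pow_succ (2 : ℝ) N, mul_pow, ← h4]
        linarith
      change ((2 ^ (N + 1)) ^ n)⁻¹ < (Real.sqrt ((normSqHS x + 2) / 4) ^ (k.natAbs + 1))⁻¹
      rw [← hn]
      have h2 := sqrt_normSqHS_pos x
      exact inv_strictAnti₀ (by positivity)
        (pow_lt_pow_left₀ h1 h2.le (by omega))
    have hαp : r ^ N * 2 ^ (-(p * n)) = α ^ p * 4 ^ N := by
      have h4 : (4 : ℝ) ^ N = 2 ^ (2 * N : ℝ) := by
        rw [Real.rpow_mul (by norm_num), Real.rpow_natCast]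
        norm_num
      have hα' : α = 2 ^ (-((N + 1) * n : ℝ)) := by
        rw [hα, Real.rpow_neg (by norm_num), ← pow_mul, ← Real.rpow_natCast]
        push_cast
        rfl
      rw [h4, hα', hr, ← Real.rpow_natCast, ← Real.rpow_mul (by norm_num),
        ← Real.rpow_mul (by norm_num), ← Real.rpow_add (by norm_num),
        ← Real.rpow_add (by norm_num)]
      congr 1
      ring
    have h4N : ENNReal.ofReal (4 ^ N) = 4 ^ N := by
      rw [ENNReal.ofReal_pow (by norm_num)]
      norm_num
    rw [hαp, ENNReal.ofReal_mul (by positivity), h4N, mul_assoc]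
    refine le_trans ?_ (le_iSup (fun α : Set.Ioi (0 : ℝ) => ENNReal.ofReal ((α : ℝ) ^ p) *
      μ {x | (α : ℝ) < decay k x}) ⟨α, hα0⟩)
    gcongr
    exact (le_measure_normSqHS_le μ N).trans (measure_mono hsub)
  have hbox := (measure_box_pos μ).ne'
  have hlt : M / μ box < ∞ := ENNReal.div_lt_top h.ne hbox
  obtain ⟨N, hN⟩ := pow_unbounded_of_one_lt ((M / μ box).toReal / 2 ^ (-(p * n))) hr1
  rw [div_lt_iff₀ (by positivity)] at hN
  have h1 : ENNReal.ofReal (r ^ N * 2 ^ (-(p * n))) ≤ M / μ box := by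
    refine (ENNReal.le_div_iff_mul_le (Or.inl hbox) (Or.inr h.ne)).2 (key N)
  exact absurd ((ENNReal.ofReal_le_iff_le_toReal hlt.ne).1 h1) (not_le.2 hN)

end SL2R

/-! ### The equivalence -/

theorem mainTheorem5 [MeasurableSpace SL2R.G] [BorelSpace SL2R.G]
    (μ : MeasureTheory.Measure SL2R.G) [μ.IsHaarMeasure]
    (p : ℝ) (hp0 : 0 < p) (hp2 : p ≤ 2) (k : ℤ) (hk : k ≠ 0) :
    2 / p - 1 ≤ |(k : ℝ)| ↔ SL2R.MemEpInfty p μ (SL2R.discreteSeries k hk) := by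
  have h : SL2R.IsDiscreteSeries k (SL2R.discreteSeries k hk) :=
    Classical.choose_spec (SL2R.exists_isDiscreteSeries k hk)
  have hiff : 2 / p - 1 ≤ |(k : ℝ)| ↔ 2 ≤ p * (k.natAbs + 1) := by
    rw [Nat.cast_natAbs, Int.cast_abs, sub_le_iff_le_add, div_le_iff₀' hp0]
  rw [hiff]
  refine ⟨fun hp => ⟨h.isIrreducible hk, fun u v hu hv => h.memWeakLp hk hp hu hv⟩,
    fun hE => ?_⟩
  -- For necessity the single diagonal coefficient of the extremal K-type suffices.
  have h0 := h.isKFinite_basisVec hk (SL2R.typeEquiv k hk 0)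
  have h1 := (hE.coeff _ _ h0 h0).2
  simp only [h.norm_matrixCoeff_lowest hk] at h1
  exact SL2R.two_le_of_iSup_decay_lt_top h1
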